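/- Let $V:\mathbb{C}\to[0,+\infty]$ be continuous with $V(\bar z)=V(z)$ for all $z$, and suppose that there is a $\delta>0$ such that $V(z)\ge(1+\delta)\log(|z|^2+1)$ for all $z$ with $|z|$ large enough. Suppose also that $E_0=\{z\in\mathbb{C}: V(z)<\infty\}$ has positive capacity, i.e. that there is a probability measure $\mu$ with compact support contained in $E_0$ such that $\iint\log|x-y|^{-1}\,d\mu(x)\,d\mu(y)<\infty$. For $n\ge1$ and $z=(z_1,\dots,z_n)\in\mathbb{C}^n$ put $z_{n+i}:=\bar z_i$ ($1\le i\le n$), $k(x,y):=\log|x-y|^{-1}+\frac12(V(x)+V(y))$ and $K_n(z):=\sum_{1\le i\ne j\le 2n}k(z_i,z_j)$. Let $P_n^V$ be the probability density on $\mathbb{C}^n$ (with respect to Lebesgue measure) $$P_n^V(z)=\frac1{c_n^V}\exp\Big(-\frac12\Big(K_n(z)+\sum_{i=1}^{2n}V(z_i)+\sum_{i=1}^{2n}\log|z_i-\bar z_i|^{-1}\Big)\Big),$$ where $c_n^V$ is the normalization constant, $\log 0^{-1}=+\infty$ and $e^{-\infty}=0$. For a probability measure $\mu$ on $\mathbb{C}$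 let $$I(\mu):=\iint\log|x-y|^{-1}\,d\mu(x)\,d\mu(y)+\int V\,d\mu,$$ with the convention $I(\mu)=+\infty$ if $\int V\,d\mu=+\infty$. Then there is a compactly supported probability measure $\mu^V$ on $\mathbb{C}$ such that $I(\mu^V)$ is finite and $\mu^V$ is the unique minimizer of $I$ on the set of all probability measures on $\mathbb{C}$. Moreover, if $z^{(n)}=(z_{n,1},\dots,z_{n,n})$, $n\ge1$, are random vectors defined on a common probability space (with an arbitrary joint distribution) such that $z^{(n)}$ has density $P_n^V$ for each $n\ge1$, then, almost surely, the empirical measures $$\frac1{2n}\sum_{i=1}^{n}\big(\delta_{z_{n,i}}+\delta_{\bar z_{n,i}}\big)$$ converge weakly to $\mu^V$ as $n\to\infty$. -/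

import Mathlib

open MeasureTheory ProbabilityTheory Filter Topology
open scoped NNReal ENNReal ComplexConjugate

noncomputable section

namespace QuatGas

/-- The integral in `[-∞, ∞]` of an extended-real valued function: the integral of its positive
part minus the integral of its negative part. It is the usual integral as soon as one of these two
is finite. -/
def extIntegral {α : Type*} [MeasurableSpace α] (μ : Measure α) (f : α → EReal) : EReal :=
  ((∫⁻ x, (f x).toENNReal ∂μ : ℝ≥0∞) : EReal) - ((∫⁻ x, (-f x).toENNReal ∂μ : ℝ≥0∞) : EReal)

/-- `log |x - y|⁻¹`, with value `+∞` when `x = y`. -/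
def logInv (x y : ℂ) : EReal := -ENNReal.log ‖x - y‖ₑ

/-- The logarithmic energy `∬ log |x - y|⁻¹ dμ(x) dμ(y)`. -/
def logEnergy (μ : Measure ℂ) : EReal :=
  extIntegral (μ.prod μ) (fun p => logInv p.1 p.2)

/-- A set has positive capacity if it contains the compact support of a probability measure with
logarithmic energy `< +∞`. -/
def HasPositiveCapacity (E : Set ℂ) : Prop :=
  ∃ μ : ProbabilityMeasure ℂ, IsCompact (μ : Measure ℂ).support ∧
    (μ : Measure ℂ).support ⊆ E ∧ logEnergy (μ : Measure ℂ) < ⊤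

open scoped Classical in
/-- The weighted logarithmic energy `∬ log |x - y|⁻¹ dμ(x) dμ(y) + ∫ V dμ`, understood to be `+∞`
when `∫ V dμ = +∞` (for such `μ` the first term may be `-∞` or undefined). -/
def weightedEnergy (V : ℂ → ℝ≥0∞) (μ : Measure ℂ) : EReal :=
  if ∫⁻ z, V z ∂μ = ⊤ then ⊤ else logEnergy μ + ((∫⁻ z, V z ∂μ : ℝ≥0∞) : EReal)

/-- `k(x, y) = log |x - y|⁻¹ + (V(x) + V(y)) / 2`. -/
def kernel (V : ℂ → ℝ≥0∞) (x y : ℂ) : EReal :=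
  logInv x y + (((V x + V y) / 2 : ℝ≥0∞) : EReal)

/-- The `2n` points `z_1, …, z_n, z_{n+1} = conj z_1, …, z_{2n} = conj z_n`. -/
def doubled {n : ℕ} (z : Fin n → ℂ) : Fin (n + n) → ℂ :=
  Fin.append z (fun i => conj (z i))

/-- `K_n(z)`, the sum of `k(z_i, z_j)` over the ordered pairs of distinct indices in
`{1, …, 2n}`. -/
def pairEnergy (V : ℂ → ℝ≥0∞) {n : ℕ} (z : Fin n → ℂ) : EReal :=
  ∑ p ∈ (Finset.univ : Finset (Fin (n + n))).offDiag, kernel V (doubled z p.1) (doubled z p.2)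

/-- The unnormalized density
`exp (-(K_n(z) + ∑_{i ≤ 2n} V(z_i) + ∑_{i ≤ 2n} log |z_i - conj z_i|⁻¹) / 2)`. -/
def weight (V : ℂ → ℝ≥0∞) {n : ℕ} (z : Fin n → ℂ) : ℝ≥0∞ :=
  EReal.exp (((-(1 / 2) : ℝ) : EReal) * (pairEnergy V z
    + ∑ i, ((V (doubled z i) : ℝ≥0∞) : EReal)
    + ∑ i, logInv (doubled z i) (conj (doubled z i))))

/-- The normalization constant `c_n^V`. -/
def partitionFunction (V : ℂ → ℝ≥0∞) (n : ℕ) : ℝ≥0∞ := ∫⁻ z : Fin n → ℂ, weight V z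

/-- The distribution on `ℂⁿ` with density `P_n^V` with respect to Lebesgue measure. -/
def gasLaw (V : ℂ → ℝ≥0∞) (n : ℕ) : Measure (Fin n → ℂ) :=
  volume.withDensity (fun z => (partitionFunction V n)⁻¹ * weight V z)

/-- The empirical measure `(1 / 2n) ∑_{i ≤ 2n} δ_{z_i} = (1 / 2n) ∑_{i ≤ n} (δ_{z_i} + δ_{conj z_i})`;
a probability measure for `n ≥ 1`. -/
def empiricalMeasure {n : ℕ} (z : Fin n → ℂ) : FiniteMeasure ℂ :=
  (2 * (n : ℝ≥0))⁻¹ • ∑ i, (diracProba (doubled z i)).toFiniteMeasure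

end QuatGas

end

/-!
Everything takes place on the Riemann sphere. Moving `log (1 + |z|²)` from the external field to the
logarithmic kernel turns `log |x - y|⁻¹` into minus the logarithm of the chordal distance
(`sphLog`), which is nonnegative, and the growth condition on `V` says that the new field
`W = V - log (1 + |z|²)`, shifted by a constant `C` to be nonnegative, is still at least of the order of `log (1 + |z|²)`
(`sphField`, `exists_shift`). All energies become integrals in `[0, ∞]` of the kernel
`fieldKernel W`, and `coe_fieldEnergy` shows that they agree with the weighted logarithmic energies
up to the constant `C`, including the infinite ones.

*The equilibrium measure.* The energy is lower semicontinuous and its sublevel sets are relatively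
compact, so a minimizer exists. Frullani's formula writes the logarithmic kernel as a superposition
of Gaussian kernels. These are strictly positive definite, so `2 I(μ, ν) < I(μ, μ) + I(ν, ν)` for
`μ ≠ ν` (`two_mul_sphEnergy_lt`). This makes the energy strictly convex and the minimizer unique
(`exists_equilibrium_measure`). Conditioning a minimizer on a large disc would lower
its energy unless the disc carries all the mass, so the support is compact.

*The gas.* As `V` is symmetric, the weight of a configuration is, up to a constant factor,
`exp (- gasEnergy W z / 2)`, where `gasEnergy W z` is the sum of `fieldKernel W` over all ordered
pairs of the `2n` points, with the pair `(z_i, conj z_i)` counted once more in place of each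
diagonal term. For independent points with distribution `ν`, Jensen's inequality bounds the partition
function below by `exp (- 2 n² (I(ν) + o(1)))`, if `ν` has a bounded density and bounded support.
The interaction of the points with the conjugates of other points has mean at most `I(ν)`, again by
positive definiteness, applied to `ν` and its conjugate (`lintegral_fieldKernel_conj_le`). Measures
`ν` of this kind come arbitrarily close to the minimal energy, since averaging translates of a
measure over a small disc hardly increases its energy (`exists_bounded_density`). On the other hand
the configurations of energy at least `4 n² (m + ε)`, where `m` is the minimal energy, have
unnormalized mass at most `exp (- 2 n² (m + ε / 2))` up to a factor exponential in `n`. So their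
probability is eventually at most `2⁻ⁿ` (`eventually_tail_le`), and by the Borel–Cantelli lemma
almost surely only finitely many of them occur.

*Convergence.* A sequence of configurations whose energy divided by `4 n²` has upper limit at most
`m` has relatively compact empirical measures, and all their limit points have energy at most `m`.
By uniqueness they converge to the equilibrium measure (`tendsto_empiricalMeasure`).
-/

namespace QuatGas

/-! ### The logarithmic kernel of the Riemann sphere -/

/-- The logarithmic growth function `log (1 + |z|²)`. -/
noncomputable def logGrowth (z : ℂ) : ℝ := Real.log (1 + ‖z‖ ^ 2)

lemma logGrowth_nonneg (z : ℂ) : 0 ≤ logGrowth z :=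
  Real.log_nonneg (by nlinarith [sq_nonneg ‖z‖])

lemma continuous_logGrowth : Continuous logGrowth := by
  unfold logGrowth
  exact Continuous.log (by fun_prop) (fun z => by positivity)

lemma exp_logGrowth (z : ℂ) : Real.exp (logGrowth z) = 1 + ‖z‖ ^ 2 :=
  Real.exp_log (by positivity)

lemma logGrowth_conj (z : ℂ) : logGrowth (conj z) = logGrowth z := by
  simp [logGrowth]

/-- The chordal distance is at most `1`. -/
lemma norm_sub_sq_le (x y : ℂ) : ‖x - y‖ ^ 2 ≤ (1 + ‖x‖ ^ 2) * (1 + ‖y‖ ^ 2) := by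
  have h : ‖x - y‖ ≤ ‖x‖ + ‖y‖ := norm_sub_le x y
  nlinarith [norm_nonneg (x - y), sq_nonneg (1 - ‖x‖ * ‖y‖), norm_nonneg x, norm_nonneg y]

lemma log_norm_sub_le {x y : ℂ} (h : x ≠ y) :
    Real.log ‖x - y‖ ≤ (logGrowth x + logGrowth y) / 2 := by
  have h0 : 0 < ‖x - y‖ := norm_pos_iff.2 (sub_ne_zero.2 h)
  have h1 := Real.log_le_log (by positivity) (norm_sub_sq_le x y)
  rw [Real.log_mul (by positivity) (by positivity), Real.log_pow] at h1
  simp only [logGrowth]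
  push_cast at h1
  linarith

lemma logInv_self (x : ℂ) : logInv x x = ⊤ := by simp [logInv]

lemma logInv_of_ne {x y : ℂ} (h : x ≠ y) : logInv x y = ((-Real.log ‖x - y‖ : ℝ) : EReal) := by
  have h0 : 0 < ‖x - y‖ := norm_pos_iff.2 (sub_ne_zero.2 h)
  rw [logInv, ← ofReal_norm, ENNReal.log_ofReal_of_pos h0, EReal.coe_neg]

/-- The logarithmic energy kernel of the Riemann sphere in the affine coordinate: minus the
logarithm of the chordal distance `|x - y| / ((1 + |x|²) (1 + |y|²))^(1/2)`. As this distance is at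
most `1`, the kernel takes values in `[0, ∞]`. -/
noncomputable def sphLog (x y : ℂ) : ℝ≥0∞ :=
  (-ENNReal.log (‖x - y‖ₑ *
    ENNReal.ofReal (Real.exp (-((logGrowth x + logGrowth y) / 2))))).toENNReal

lemma sphLog_self (x : ℂ) : sphLog x x = ⊤ := by simp [sphLog]

lemma sphLog_of_ne {x y : ℂ} (h : x ≠ y) :
    sphLog x y = ENNReal.ofReal (-Real.log ‖x - y‖ + (logGrowth x + logGrowth y) / 2) := by
  have h0 : 0 < ‖x - y‖ := norm_pos_iff.2 (sub_ne_zero.2 h)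
  rw [sphLog, ENNReal.log_mul_add, ← ofReal_norm, ENNReal.log_ofReal_of_pos h0,
    ENNReal.log_ofReal_of_pos (Real.exp_pos _), Real.log_exp, ← EReal.coe_add, ← EReal.coe_neg,
    EReal.toENNReal_of_ne_top (EReal.coe_ne_top _), EReal.toReal_coe]
  congr 1; ring

lemma continuous_sphLog : Continuous fun p : ℂ × ℂ => sphLog p.1 p.2 := by
  unfold sphLog
  refine Continuous.ereal_toENNReal (Continuous.neg (ENNReal.continuous_log.comp ?_))
  have h1 : Continuous fun p : ℂ × ℂ =>
      ENNReal.ofReal (Real.exp (-((logGrowth p.1 + logGrowth p.2) / 2))) := by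
    have := continuous_logGrowth
    exact ENNReal.continuous_ofReal.comp (by fun_prop)
  have h2 : Continuous fun p : ℂ × ℂ => ‖p.1 - p.2‖ₑ := by fun_prop
  refine continuous_iff_continuousAt.2 fun p => ?_
  refine ENNReal.Tendsto.mul h2.continuousAt (Or.inr ENNReal.ofReal_ne_top) h1.continuousAt
    (Or.inr enorm_ne_top)

lemma sphLog_comm (x y : ℂ) : sphLog x y = sphLog y x := by
  unfold sphLog
  rw [← enorm_neg, neg_sub, add_comm]

lemma sphLog_conj (x y : ℂ) : sphLog (conj x) (conj y) = sphLog x y := by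
  unfold sphLog
  rw [← map_sub, logGrowth_conj, logGrowth_conj, ← ofReal_norm, ← ofReal_norm,
    RCLike.norm_conj]

/-- The spherical kernel is the planar one up to a sum of functions of a single variable. -/
lemma coe_sphLog (x y : ℂ) :
    (sphLog x y : EReal) = logInv x y + (((logGrowth x + logGrowth y) / 2 : ℝ) : EReal) := by
  rcases eq_or_ne x y with rfl | h
  · rw [sphLog_self, logInv_self]; rfl
  · rw [sphLog_of_ne h, logInv_of_ne h, EReal.coe_ennreal_ofReal, max_eq_left, EReal.coe_add]
    have := log_norm_sub_le h
    linarith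

lemma measurable_sphLog : Measurable fun p : ℂ × ℂ => sphLog p.1 p.2 :=
  continuous_sphLog.measurable

lemma measurable_sphLog_left (x : ℂ) : Measurable (sphLog x) := by
  have h : Continuous fun y : ℂ => (x, y) := by fun_prop
  exact (continuous_sphLog.comp h).measurable

/-- The spherical logarithmic kernel in an external field `W`. -/
noncomputable def fieldKernel (W : ℂ → ℝ≥0∞) (x y : ℂ) : ℝ≥0∞ := sphLog x y + (W x + W y) / 2

lemma fieldKernel_comm (W : ℂ → ℝ≥0∞) (x y : ℂ) : fieldKernel W x y = fieldKernel W y x := by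
  rw [fieldKernel, fieldKernel, sphLog_comm, add_comm (W x)]

lemma continuous_fieldKernel {W : ℂ → ℝ≥0∞} (hW : Continuous W) :
    Continuous fun p : ℂ × ℂ => fieldKernel W p.1 p.2 := by
  unfold fieldKernel
  refine continuous_sphLog.add ?_
  exact ENNReal.continuous_div_const 2 (by simp) |>.comp (by fun_prop)

/-- The external field `V + C - log (1 + |z|²)` on the Riemann sphere that corresponds to the
potential `V`, shifted by a constant `C` (chosen such that the subtraction is not truncated). -/
noncomputable def sphField (V : ℂ → ℝ≥0∞) (C : ℝ≥0) (z : ℂ) : ℝ≥0∞ :=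
  V z + C - ENNReal.ofReal (logGrowth z)

lemma continuous_sphField {V : ℂ → ℝ≥0∞} (hV : Continuous V) (C : ℝ≥0) :
    Continuous (sphField V C) := by
  unfold sphField
  refine continuous_iff_continuousAt.2 fun z => ?_
  refine ENNReal.Tendsto.sub ?_ ?_ (Or.inr ENNReal.ofReal_ne_top)
  · exact (hV.add continuous_const).continuousAt
  · exact (ENNReal.continuous_ofReal.comp continuous_logGrowth).continuousAt

lemma sphField_add {V : ℂ → ℝ≥0∞} {C : ℝ≥0}
    (hC : ∀ z, ENNReal.ofReal (logGrowth z) ≤ V z + C) (z : ℂ) :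
    sphField V C z + ENNReal.ofReal (logGrowth z) = V z + C :=
  tsub_add_cancel_of_le (hC z)

lemma sphField_conj {V : ℂ → ℝ≥0∞} (hconj : ∀ z, V (conj z) = V z) (C : ℝ≥0) (z : ℂ) :
    sphField V C (conj z) = sphField V C z := by
  rw [sphField, sphField, hconj, logGrowth_conj]

/-- Passing to the sphere moves `(log (1 + |x|²) + log (1 + |y|²)) / 2` from the field to the
logarithmic kernel: the total kernel changes only by the constant `C`. -/
lemma coe_fieldKernel {V : ℂ → ℝ≥0∞} {C : ℝ≥0}
    (hC : ∀ z, ENNReal.ofReal (logGrowth z) ≤ V z + C) (x y : ℂ) :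
    (fieldKernel (sphField V C) x y : EReal) = kernel V x y + ((C : ℝ) : EReal) := by
  have hbot : ((logInv x y : EReal)) ≠ ⊥ := by
    rcases eq_or_ne x y with rfl | h
    · simp [logInv_self]
    · simp [logInv_of_ne h]
  have key : sphField V C x + sphField V C y + ENNReal.ofReal (logGrowth x + logGrowth y)
      = V x + V y + (C + C) := by
    rw [ENNReal.ofReal_add (logGrowth_nonneg x) (logGrowth_nonneg y)]
    calc _ = (sphField V C x + ENNReal.ofReal (logGrowth x)) +
          (sphField V C y + ENNReal.ofReal (logGrowth y)) := by ring
      _ = _ := by rw [sphField_add hC, sphField_add hC]; ring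
  have key2 : ENNReal.ofReal ((logGrowth x + logGrowth y) / 2) +
      (sphField V C x + sphField V C y) / 2 = (V x + V y) / 2 + C := by
    have h2 : ENNReal.ofReal ((logGrowth x + logGrowth y) / 2)
        = ENNReal.ofReal (logGrowth x + logGrowth y) / 2 := by
      rw [ENNReal.ofReal_div_of_pos (by norm_num)]; simp
    rw [h2, ← ENNReal.add_div, add_comm, key, ENNReal.add_div]
    congr 1
    rw [← two_mul, mul_comm, ENNReal.mul_div_cancel_right (by simp) (by simp)]
  have h3 : (((logGrowth x + logGrowth y) / 2 : ℝ) : EReal) =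
      ((ENNReal.ofReal ((logGrowth x + logGrowth y) / 2) : ℝ≥0∞) : EReal) := by
    rw [EReal.coe_ennreal_ofReal, max_eq_left]
    have := logGrowth_nonneg x; have := logGrowth_nonneg y; positivity
  rw [fieldKernel, EReal.coe_ennreal_add, coe_sphLog, add_assoc, h3, ← EReal.coe_ennreal_add, key2,
    kernel, EReal.coe_ennreal_add, add_assoc]
  rfl

/-! ### Positive definiteness of Gaussian kernels -/

/-- The Gaussian bump `exp (-2 s |x - w|²)` centred at `w`. -/
noncomputable def gaussBump (s : ℝ) (w x : ℂ) : ℝ≥0∞ :=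
  ENNReal.ofReal (Real.exp (-(2 * s) * ‖x - w‖ ^ 2))

/-- The Gaussian kernel `exp (-s |x - y|²)`. -/
noncomputable def gaussKernel (s : ℝ) (x y : ℂ) : ℝ≥0∞ :=
  ENNReal.ofReal (Real.exp (-s * ‖x - y‖ ^ 2))

lemma integrable_exp_neg_mul_norm_sq {b : ℝ} (hb : 0 < b) :
    Integrable fun v : ℂ => Real.exp (-b * ‖v‖ ^ 2) := by
  by_contra h
  -- otherwise the Gaussian integral would have the junk value `0`
  have h1 := integral_undef h
  rw [GaussianFourier.integral_rexp_neg_mul_sq_norm hb] at h1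
  exact (Real.rpow_pos_of_pos (div_pos Real.pi_pos hb) _).ne' h1

lemma lintegral_exp_neg_mul_norm_sq {b : ℝ} (hb : 0 < b) :
    (∫⁻ v : ℂ, ENNReal.ofReal (Real.exp (-b * ‖v‖ ^ 2))) ≠ 0 ∧
    (∫⁻ v : ℂ, ENNReal.ofReal (Real.exp (-b * ‖v‖ ^ 2))) ≠ ⊤ := by
  rw [← ofReal_integral_eq_lintegral_ofReal (integrable_exp_neg_mul_norm_sq hb)
    (Eventually.of_forall fun _ => (Real.exp_pos _).le),
    GaussianFourier.integral_rexp_neg_mul_sq_norm hb]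
  refine ⟨?_, ENNReal.ofReal_ne_top⟩
  have := Real.rpow_pos_of_pos (div_pos Real.pi_pos hb) (Module.finrank ℝ ℂ / 2 : ℝ)
  simpa using this

lemma measurable_gaussBump (s : ℝ) : Measurable fun p : ℂ × ℂ => gaussBump s p.1 p.2 := by
  unfold gaussBump; fun_prop

lemma measurable_gaussBump_left (s : ℝ) (w : ℂ) : Measurable (gaussBump s w) := by
  unfold gaussBump; fun_prop

lemma measurable_gaussKernel (s : ℝ) : Measurable fun p : ℂ × ℂ => gaussKernel s p.1 p.2 := by
  unfold gaussKernel; fun_prop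

/-- The Gaussian kernel is the overlap of two Gaussian bumps of half its width. -/
lemma lintegral_gaussBump_mul (s : ℝ) (x y : ℂ) :
    ∫⁻ w, gaussBump s w x * gaussBump s w y =
      (∫⁻ v : ℂ, ENNReal.ofReal (Real.exp (-(4 * s) * ‖v‖ ^ 2))) * gaussKernel s x y := by
  have h : ∀ w : ℂ, gaussBump s w x * gaussBump s w y =
      ENNReal.ofReal (Real.exp (-(4 * s) * ‖w - (x + y) / 2‖ ^ 2)) * gaussKernel s x y := by
    intro w
    rw [gaussBump, gaussBump, gaussKernel, ← ENNReal.ofReal_mul (Real.exp_pos _).le,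
      ← ENNReal.ofReal_mul (Real.exp_pos _).le, ← Real.exp_add, ← Real.exp_add]
    congr 2
    simp only [Complex.sq_norm, Complex.normSq_apply]
    simp
    ring
  simp_rw [h]
  rw [lintegral_mul_const' _ _ (by simp [gaussKernel]),
    lintegral_sub_right_eq_self
      (fun v : ℂ => ENNReal.ofReal (Real.exp (-(4 * s) * ‖v‖ ^ 2))) ((x + y) / 2)]

/-- The Gaussian smoothing of a measure. -/
noncomputable def gaussSmooth (s : ℝ) (μ : Measure ℂ) (w : ℂ) : ℝ≥0∞ := ∫⁻ x, gaussBump s w x ∂μ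

lemma measurable_gaussSmooth (s : ℝ) (μ : Measure ℂ) [SFinite μ] : Measurable (gaussSmooth s μ) :=
  (measurable_gaussBump s).lintegral_prod_right'

lemma gaussSmooth_ne_top {s : ℝ} (hs : 0 ≤ s) (μ : Measure ℂ) [IsProbabilityMeasure μ] (w : ℂ) :
    gaussSmooth s μ w ≠ ⊤ := by
  refine ne_top_of_le_ne_top (b := 1) (by simp) ?_
  calc gaussSmooth s μ w ≤ ∫⁻ _, 1 ∂μ := by
        refine lintegral_mono fun x => ?_
        rw [gaussBump, ENNReal.ofReal_le_one, Real.exp_le_one_iff]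
        have : 0 ≤ 2 * s * ‖x - w‖ ^ 2 := by positivity
        linarith
    _ = 1 := by simp

/-- The Gaussian energy of a pair of measures. -/
noncomputable def gaussEnergy (s : ℝ) (μ ν : Measure ℂ) : ℝ≥0∞ :=
  ∫⁻ p, gaussKernel s p.1 p.2 ∂(μ.prod ν)

lemma lintegral_gaussSmooth_mul (s : ℝ) (μ ν : Measure ℂ) [SFinite μ] [SFinite ν] :
    ∫⁻ w, gaussSmooth s μ w * gaussSmooth s ν w =
      (∫⁻ v : ℂ, ENNReal.ofReal (Real.exp (-(4 * s) * ‖v‖ ^ 2))) * gaussEnergy s μ ν := by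
  have hm1 := measurable_gaussBump_left s
  calc ∫⁻ w, gaussSmooth s μ w * gaussSmooth s ν w
      = ∫⁻ w, ∫⁻ p : ℂ × ℂ, gaussBump s w p.1 * gaussBump s w p.2 ∂(μ.prod ν) := by
        refine lintegral_congr fun w => ?_
        rw [lintegral_prod_mul (hm1 w).aemeasurable (hm1 w).aemeasurable]; rfl
    _ = ∫⁻ p : ℂ × ℂ, (∫⁻ w, gaussBump s w p.1 * gaussBump s w p.2) ∂(μ.prod ν) := by
        refine lintegral_lintegral_swap (Measurable.aemeasurable ?_)
        unfold gaussBump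
        fun_prop
    _ = _ := by
        simp_rw [lintegral_gaussBump_mul]
        rw [lintegral_const_mul _ (measurable_gaussKernel s)]; rfl

lemma two_mul_mul_le_sq_add_sq (a b : ℝ≥0∞) : 2 * (a * b) ≤ a * a + b * b := by
  rcases eq_or_ne a ⊤ with rfl | ha
  · simp
  rcases eq_or_ne b ⊤ with rfl | hb
  · simp
  lift a to ℝ≥0 using ha
  lift b to ℝ≥0 using hb
  norm_cast
  have := two_mul_le_add_sq a b
  calc 2 * (a * b) = 2 * a * b := by ring
    _ ≤ _ := this
    _ = _ := by ring

/-- The Gaussian kernel is positive definite: the energies are `L²` inner products of Gaussian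
smoothings. -/
lemma two_mul_gaussEnergy_le {s : ℝ} (hs : 0 < s) (μ ν : Measure ℂ) [SFinite μ] [SFinite ν] :
    2 * gaussEnergy s μ ν ≤ gaussEnergy s μ μ + gaussEnergy s ν ν := by
  obtain ⟨h0, h1⟩ := lintegral_exp_neg_mul_norm_sq (b := 4 * s) (by positivity)
  rw [← ENNReal.mul_le_mul_iff_right h0 h1, mul_add, ← lintegral_gaussSmooth_mul,
    ← lintegral_gaussSmooth_mul, mul_left_comm, ← lintegral_gaussSmooth_mul]
  have m11 : Measurable fun w => gaussSmooth s μ w * gaussSmooth s μ w :=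
    (measurable_gaussSmooth s μ).mul (measurable_gaussSmooth s μ)
  have m12 : Measurable fun w => gaussSmooth s μ w * gaussSmooth s ν w :=
    (measurable_gaussSmooth s μ).mul (measurable_gaussSmooth s ν)
  have m22 : Measurable fun w => gaussSmooth s ν w * gaussSmooth s ν w :=
    (measurable_gaussSmooth s ν).mul (measurable_gaussSmooth s ν)
  rw [← lintegral_add_left m11, ← lintegral_const_mul _ m12]
  exact lintegral_mono fun w => two_mul_mul_le_sq_add_sq _ _

lemma gaussEnergy_le_one {s : ℝ} (hs : 0 ≤ s) (μ ν : Measure ℂ) [IsProbabilityMeasure μ]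
    [IsProbabilityMeasure ν] : gaussEnergy s μ ν ≤ 1 := by
  calc gaussEnergy s μ ν ≤ ∫⁻ _, 1 ∂(μ.prod ν) := by
        refine lintegral_mono fun p => ?_
        rw [gaussKernel, ENNReal.ofReal_le_one, Real.exp_le_one_iff]
        have : 0 ≤ s * ‖p.1 - p.2‖ ^ 2 := by positivity
        linarith
    _ = 1 := by simp

/-- The centred Gaussian measure with density `gaussBump s 0`; it is not normalized. -/
noncomputable def gaussMeasure (s : ℝ) : Measure ℂ := volume.withDensity (gaussBump s 0)

lemma isFiniteMeasure_gaussMeasure {s : ℝ} (hs : 0 < s) : IsFiniteMeasure (gaussMeasure s) := by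
  refine isFiniteMeasure_withDensity ?_
  simpa [gaussBump] using (lintegral_exp_neg_mul_norm_sq (b := 2 * s) (by positivity)).2

lemma conv_gaussMeasure (s : ℝ) (μ : Measure ℂ) [SFinite μ] :
    μ.conv (gaussMeasure s) = volume.withDensity (gaussSmooth s μ) := by
  have hm1 := measurable_gaussBump_left s 0
  have : SFinite (gaussMeasure s) := by unfold gaussMeasure; infer_instance
  refine Measure.ext_of_lintegral _ fun f hf => ?_
  rw [Measure.lintegral_conv hf, lintegral_withDensity_eq_lintegral_mul _
    (measurable_gaussSmooth s μ) hf]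
  have h1 : ∀ x : ℂ, ∫⁻ y, f (x + y) ∂(gaussMeasure s) = ∫⁻ w, gaussBump s w x * f w := by
    intro x
    rw [gaussMeasure, lintegral_withDensity_eq_lintegral_mul _ hm1 (by fun_prop),
      ← lintegral_sub_right_eq_self _ x]
    refine lintegral_congr fun w => ?_
    simp [gaussBump, norm_sub_rev]
  simp_rw [h1]
  rw [lintegral_lintegral_swap]
  · refine lintegral_congr fun w => ?_
    rw [lintegral_mul_const _ (measurable_gaussBump_left s w)]
    rfl
  · refine Measurable.aemeasurable ?_
    unfold gaussBump
    fun_prop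

lemma charFun_gaussMeasure_ne_zero {s : ℝ} (hs : 0 < s) (t : ℂ) :
    charFun (gaussMeasure s) t ≠ 0 := by
  have h1 : charFun (gaussMeasure s) t =
      ∫ v : ℂ, Complex.exp (-((2 * s : ℝ) : ℂ) * ‖v‖ ^ 2 + Complex.I * (inner ℝ t v : ℝ)) := by
    rw [charFun_apply, gaussMeasure, integral_withDensity_eq_integral_toReal_smul
      (measurable_gaussBump_left s 0) (by simp [gaussBump])]
    refine integral_congr_ae (Eventually.of_forall fun v => ?_)
    simp only [gaussBump, sub_zero, ENNReal.toReal_ofReal (Real.exp_pos _).le, Complex.exp_add,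
      real_inner_comm v t, Complex.real_smul]
    push_cast
    rw [mul_comm (Complex.I)]
  rw [h1, GaussianFourier.integral_cexp_neg_mul_sq_norm_add (by simpa using hs)]
  refine mul_ne_zero ?_ (Complex.exp_ne_zero _)
  rw [Complex.cpow_ne_zero_iff]
  left
  have := Real.pi_pos
  refine div_ne_zero (by exact_mod_cast this.ne') (by exact_mod_cast (by positivity : 2 * s ≠ 0))

/-- The Gaussian kernel is strictly positive definite: equality forces the Gaussian smoothings of
`μ` and `ν` to agree, and a Gaussian has no zero in its characteristic function. -/
lemma eq_of_gaussEnergy_eq {s : ℝ} (hs : 0 < s) (μ ν : Measure ℂ) [IsProbabilityMeasure μ]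
    [IsProbabilityMeasure ν]
    (h : gaussEnergy s μ μ + gaussEnergy s ν ν ≤ 2 * gaussEnergy s μ ν) : μ = ν := by
  obtain ⟨h0, h1⟩ := lintegral_exp_neg_mul_norm_sq (b := 4 * s) (by positivity)
  have m11 : Measurable fun w => gaussSmooth s μ w * gaussSmooth s μ w :=
    (measurable_gaussSmooth s μ).mul (measurable_gaussSmooth s μ)
  have m12 : Measurable fun w => gaussSmooth s μ w * gaussSmooth s ν w :=
    (measurable_gaussSmooth s μ).mul (measurable_gaussSmooth s ν)
  have m22 : Measurable fun w => gaussSmooth s ν w * gaussSmooth s ν w :=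
    (measurable_gaussSmooth s ν).mul (measurable_gaussSmooth s ν)
  have hfin : 2 * gaussEnergy s μ ν ≠ ⊤ := ENNReal.mul_ne_top (by simp)
    (ne_top_of_le_ne_top (by simp) (gaussEnergy_le_one hs.le μ ν))
  have h2 := mul_le_mul_right h (∫⁻ v : ℂ, ENNReal.ofReal (Real.exp (-(4 * s) * ‖v‖ ^ 2)))
  have h3 := ENNReal.mul_ne_top h1 hfin
  rw [mul_left_comm, ← lintegral_gaussSmooth_mul, ← lintegral_const_mul _ m12] at h3
  rw [mul_add, ← lintegral_gaussSmooth_mul,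
    ← lintegral_gaussSmooth_mul, mul_left_comm, ← lintegral_gaussSmooth_mul,
    ← lintegral_add_left m11, ← lintegral_const_mul _ m12] at h2
  have h4 := ae_eq_of_ae_le_of_lintegral_le
    (Eventually.of_forall fun w => two_mul_mul_le_sq_add_sq (gaussSmooth s μ w) (gaussSmooth s ν w))
    h3 (m11.add m22).aemeasurable h2
  have h5 : gaussSmooth s μ =ᵐ[volume] gaussSmooth s ν := by
    filter_upwards [h4] with w hw
    have ha := gaussSmooth_ne_top hs.le μ w
    have hb := gaussSmooth_ne_top hs.le ν w
    generalize gaussSmooth s μ w = a at *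
    generalize gaussSmooth s ν w = b at *
    lift a to ℝ≥0 using ha
    lift b to ℝ≥0 using hb
    norm_cast at hw ⊢
    have hw' : (2 * (a * b) : ℝ) = a * a + b * b := by exact_mod_cast hw
    have : ((a : ℝ) - b) ^ 2 = 0 := by linarith
    exact NNReal.coe_injective (by nlinarith [pow_eq_zero_iff (two_ne_zero) |>.1 this])
  have := isFiniteMeasure_gaussMeasure hs
  have h6 : μ.conv (gaussMeasure s) = ν.conv (gaussMeasure s) := by
    rw [conv_gaussMeasure, conv_gaussMeasure, withDensity_congr_ae h5]
  refine Measure.ext_of_charFun (funext fun t => ?_)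
  have h7 := congrArg (fun m => charFun m t) h6
  simp only [charFun_conv] at h7
  exact mul_right_cancel₀ (charFun_gaussMeasure_ne_zero hs t) h7

/-! ### The logarithmic kernel as a mixture of Gaussian kernels -/

lemma integrableOn_exp_neg_div {a : ℝ} (ha : 0 < a) :
    IntegrableOn (fun u : ℝ => Real.exp (-u) / u) (Set.Ioi a) := by
  have h1 : IntegrableOn (fun u : ℝ => Real.exp (-1 * u) * a⁻¹) (Set.Ioi a) :=
    (exp_neg_integrableOn_Ioi a one_pos).mul_const _
  refine h1.mono' (Measurable.aestronglyMeasurable (by fun_prop)) ?_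
  filter_upwards [ae_restrict_mem measurableSet_Ioi] with u hu
  have hu' : a < u := hu
  rw [Real.norm_of_nonneg (div_nonneg (Real.exp_pos _).le (ha.trans hu').le), div_eq_mul_inv,
    neg_one_mul]
  gcongr

/-- The exponential integral `∫_a^∞ e^{-u} / u du`. -/
noncomputable def expInt (a : ℝ) : ℝ := ∫ u in Set.Ioi a, Real.exp (-u) / u

lemma expInt_nonneg {a : ℝ} (ha : 0 < a) : 0 ≤ expInt a :=
  setIntegral_nonneg measurableSet_Ioi fun _ hu =>
    div_nonneg (Real.exp_pos _).le (ha.trans hu).le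

lemma expInt_sub_bounds {a c : ℝ} (ha : 0 < a) (hac : a ≤ c) :
    Real.exp (-c) * Real.log (c / a) ≤ expInt a - expInt c ∧
      expInt a - expInt c ≤ Real.log (c / a) := by
  rw [expInt, expInt, intervalIntegral.integral_Ioi_sub_Ioi (integrableOn_exp_neg_div ha) hac]
  have h0 : (0 : ℝ) ∉ Set.uIcc a c := by
    rw [Set.uIcc_of_le hac]; exact fun h => absurd h.1 (not_le.2 ha)
  have hpos : ∀ u ∈ Set.uIcc a c, u ≠ 0 := fun u hu h => h0 (h ▸ hu)
  have i1 : IntervalIntegrable (fun u : ℝ => 1 / u) volume a c :=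
    intervalIntegral.intervalIntegrable_one_div hpos continuousOn_id
  have i2 : IntervalIntegrable (fun u : ℝ => Real.exp (-u) / u) volume a c :=
    ContinuousOn.intervalIntegrable (ContinuousOn.div (by fun_prop) continuousOn_id hpos)
  rw [← integral_one_div h0, ← intervalIntegral.integral_const_mul]
  constructor
  · refine intervalIntegral.integral_mono_on hac (i1.const_mul _) i2 fun u hu => ?_
    have : 0 < u := ha.trans_le hu.1
    rw [mul_one_div]
    gcongr
    exact hu.2
  · refine intervalIntegral.integral_mono_on hac i2 i1 fun u hu => ?_
    have : 0 < u := ha.trans_le hu.1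
    gcongr
    rw [Real.exp_le_one_iff]; linarith

/-- One half of Frullani's formula `∫_0^∞ (e^{-s b} - e^{-s}) / s ds = - log b`, for `b ≤ 1`, with
error bounds. -/
lemma expInt_sub_of_le_one {ε b : ℝ} (hε : 0 < ε) (hb : 0 < b) (hb1 : b ≤ 1) :
    Real.exp (-ε) * (-Real.log b) ≤ expInt (b * ε) - expInt ε ∧
      expInt (b * ε) - expInt ε ≤ -Real.log b := by
  have h := expInt_sub_bounds (a := b * ε) (c := ε) (by positivity) (by nlinarith)
  have e : ε / (b * ε) = b⁻¹ := by field_simp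
  rwa [e, Real.log_inv] at h

lemma expInt_sub_of_one_le {ε b : ℝ} (hε : 0 < ε) (hb1 : 1 ≤ b) :
    Real.exp (-(b * ε)) * Real.log b ≤ expInt ε - expInt (b * ε) ∧
      expInt ε - expInt (b * ε) ≤ Real.log b := by
  have h := expInt_sub_bounds (a := ε) (c := b * ε) hε (by nlinarith)
  have e : b * ε / ε = b := by field_simp
  rwa [e] at h

lemma tendsto_expInt_sub {b : ℝ} (hb : 0 < b) {ε : ℕ → ℝ} (hε : ∀ m, 0 < ε m)
    (h0 : Tendsto ε atTop (𝓝 0)) :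
    Tendsto (fun m => expInt (b * ε m) - expInt (ε m)) atTop (𝓝 (-Real.log b)) := by
  rcases le_total b 1 with hb1 | hb1
  · have h1 : Tendsto (fun m => Real.exp (-ε m) * (-Real.log b)) atTop (𝓝 (-Real.log b)) := by
      have : Tendsto (fun m => Real.exp (-ε m)) atTop (𝓝 (Real.exp (-0))) :=
        (Real.continuous_exp.tendsto _).comp h0.neg
      simpa using this.mul_const (-Real.log b)
    exact tendsto_of_tendsto_of_tendsto_of_le_of_le h1 tendsto_const_nhds
      (fun m => (expInt_sub_of_le_one (hε m) hb hb1).1)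
      (fun m => (expInt_sub_of_le_one (hε m) hb hb1).2)
  · have h1 : Tendsto (fun m => -(Real.exp (-(b * ε m)) * Real.log b)) atTop (𝓝 (-Real.log b)) := by
      have : Tendsto (fun m => Real.exp (-(b * ε m))) atTop (𝓝 (Real.exp (-(b * 0)))) :=
        (Real.continuous_exp.tendsto _).comp (h0.const_mul b).neg
      simpa using (this.mul_const (Real.log b)).neg
    refine tendsto_of_tendsto_of_tendsto_of_le_of_le tendsto_const_nhds h1
      (fun m => ?_) (fun m => ?_)
    · have := (expInt_sub_of_one_le (hε m) hb1).2
      simp only; linarith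
    · have := (expInt_sub_of_one_le (hε m) hb1).1
      simp only; linarith

/-- The superposition `∫_ε^∞ e^{-s |x - y|²} ds / s` of Gaussian kernels. -/
noncomputable def gaussTail (ε : ℝ) (x y : ℂ) : ℝ≥0∞ :=
  ∫⁻ s in Set.Ioi ε, ENNReal.ofReal s⁻¹ * gaussKernel s x y

/-- The substitution `u = s |x - y|²`. -/
lemma gaussTail_of_ne {ε : ℝ} (hε : 0 < ε) {x y : ℂ} (h : x ≠ y) :
    gaussTail ε x y = ENNReal.ofReal (expInt (‖x - y‖ ^ 2 * ε)) := by
  have hb : 0 < ‖x - y‖ ^ 2 := by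
    have : 0 < ‖x - y‖ := norm_pos_iff.2 (sub_ne_zero.2 h)
    positivity
  generalize hbd : ‖x - y‖ ^ 2 = b at hb
  have e1 : ∀ s : ℝ, Real.exp (-(b * s)) / (b * s) = b⁻¹ * (s⁻¹ * Real.exp (-s * b)) := by
    intro s
    rw [neg_mul, mul_comm s b, div_eq_mul_inv, mul_inv]; ring
  have h1 := integral_comp_mul_left_Ioi (fun u : ℝ => Real.exp (-u) / u) ε hb
  have h2 : IntegrableOn (fun s : ℝ => s⁻¹ * Real.exp (-s * b)) (Set.Ioi ε) := by
    have := (integrableOn_Ioi_comp_mul_left_iff (fun u : ℝ => Real.exp (-u) / u) ε hb).2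
      (integrableOn_exp_neg_div (by positivity))
    simp_rw [e1] at this
    have h3 := this.const_mul b
    refine h3.congr (Eventually.of_forall fun s => ?_)
    simp only
    rw [← mul_assoc, mul_inv_cancel₀ hb.ne', one_mul]
  simp_rw [e1] at h1
  rw [integral_const_mul, smul_eq_mul] at h1
  have h4 := mul_left_cancel₀ (inv_ne_zero hb.ne') h1
  rw [expInt, ← h4, ofReal_integral_eq_lintegral_ofReal h2, gaussTail]
  · refine setLIntegral_congr_fun measurableSet_Ioi fun s hs => ?_
    have : 0 < s := hε.trans hs
    simp only [gaussKernel]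
    rw [hbd, ← ENNReal.ofReal_mul (by positivity)]
  · filter_upwards [ae_restrict_mem measurableSet_Ioi] with s hs
    have : 0 < s := hε.trans hs
    simp only [Pi.zero_apply]
    positivity

lemma gaussTail_self {ε : ℝ} (hε : 0 < ε) (x : ℂ) : gaussTail ε x x = ⊤ := by
  by_contra h
  refine not_integrableOn_Ioi_inv (a := ε) ⟨by fun_prop, ?_⟩
  rw [hasFiniteIntegral_iff_ofReal]
  · refine lt_of_le_of_lt (le_of_eq ?_) (lt_top_iff_ne_top.2 h)
    simp [gaussTail, gaussKernel]
  · filter_upwards [ae_restrict_mem measurableSet_Ioi] with s hs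
    exact inv_nonneg.2 (hε.trans hs).le

lemma measurable_gaussTail (ε : ℝ) : Measurable fun p : ℂ × ℂ => gaussTail ε p.1 p.2 := by
  unfold gaussTail gaussKernel
  refine Measurable.lintegral_prod_right' (f := fun q : (ℂ × ℂ) × ℝ => ENNReal.ofReal q.2⁻¹ *
    ENNReal.ofReal (Real.exp (-q.2 * ‖q.1.1 - q.1.2‖ ^ 2))) ?_
  fun_prop

/-- Twice the spherical logarithmic kernel, with the Gaussians of width more than `ε^(-1/2)` left
out of its Frullani representation. The subtraction is not truncated, by `sphLogApprox_add`. -/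
noncomputable def sphLogApprox (ε : ℝ) (x y : ℂ) : ℝ≥0∞ :=
  (gaussTail ε x y + (ENNReal.ofReal (logGrowth x) + ENNReal.ofReal (logGrowth y)))
    - ENNReal.ofReal (expInt ε)

lemma measurable_sphLogApprox (ε : ℝ) : Measurable fun p : ℂ × ℂ => sphLogApprox ε p.1 p.2 := by
  unfold sphLogApprox
  have := continuous_logGrowth.measurable
  exact ((measurable_gaussTail ε).add (by fun_prop)).sub measurable_const

lemma sphLogApprox_self {ε : ℝ} (hε : 0 < ε) (x : ℂ) : sphLogApprox ε x x = ⊤ := by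
  simp [sphLogApprox, gaussTail_self hε]

lemma sphLogApprox_of_ne {ε : ℝ} (hε : 0 < ε) {x y : ℂ} (h : x ≠ y) :
    sphLogApprox ε x y = ENNReal.ofReal
      (expInt (‖x - y‖ ^ 2 * ε) - expInt ε + (logGrowth x + logGrowth y)) := by
  have hb : 0 < ‖x - y‖ := norm_pos_iff.2 (sub_ne_zero.2 h)
  have hx := logGrowth_nonneg x
  have hy := logGrowth_nonneg y
  have hE := expInt_nonneg (a := ‖x - y‖ ^ 2 * ε) (by positivity)
  rw [sphLogApprox, gaussTail_of_ne hε h, ← ENNReal.ofReal_add hx hy,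
    ← ENNReal.ofReal_add hE (by positivity), ← ENNReal.ofReal_sub _ (expInt_nonneg hε)]
  congr 1; ring

lemma two_mul_sphLog_of_ne {x y : ℂ} (h : x ≠ y) : 2 * sphLog x y =
    ENNReal.ofReal (-Real.log (‖x - y‖ ^ 2) + (logGrowth x + logGrowth y)) := by
  rw [sphLog_of_ne h, ← ENNReal.ofReal_ofNat, ← ENNReal.ofReal_mul (by norm_num), Real.log_pow]
  congr 1; push_cast; ring

lemma sphLogApprox_add {ε : ℝ} (hε : 0 < ε) (x y : ℂ) :
    sphLogApprox ε x y + ENNReal.ofReal (expInt ε) =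
      gaussTail ε x y + (ENNReal.ofReal (logGrowth x) + ENNReal.ofReal (logGrowth y)) := by
  refine tsub_add_cancel_of_le ?_
  rcases eq_or_ne x y with rfl | h
  · simp [gaussTail_self hε]
  have hb : 0 < ‖x - y‖ := norm_pos_iff.2 (sub_ne_zero.2 h)
  have hx := logGrowth_nonneg x
  have hy := logGrowth_nonneg y
  have hE := expInt_nonneg (a := ‖x - y‖ ^ 2 * ε) (by positivity)
  rw [gaussTail_of_ne hε h, ← ENNReal.ofReal_add hx hy, ← ENNReal.ofReal_add hE (by positivity)]
  refine ENNReal.ofReal_le_ofReal ?_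
  rcases le_total (‖x - y‖ ^ 2) 1 with h1 | h1
  · have h2 := (expInt_sub_of_le_one hε (by positivity) h1).1
    have h3 : 0 ≤ Real.exp (-ε) * (-Real.log (‖x - y‖ ^ 2)) :=
      mul_nonneg (Real.exp_pos _).le (neg_nonneg.2 (Real.log_nonpos (by positivity) h1))
    linarith
  · have h2 := (expInt_sub_of_one_le hε h1).2
    have h3 := log_norm_sub_le h
    rw [Real.log_pow] at h2
    push_cast at h2
    linarith

/-- A bound uniform in `ε`, for dominated convergence. -/
lemma sphLogApprox_le {ε : ℝ} (hε : 0 < ε) (x y : ℂ) :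
    sphLogApprox ε x y ≤
      2 * sphLog x y + (ENNReal.ofReal (logGrowth x) + ENNReal.ofReal (logGrowth y)) := by
  rcases eq_or_ne x y with rfl | h
  · simp [sphLog_self]
  have hb : 0 < ‖x - y‖ := norm_pos_iff.2 (sub_ne_zero.2 h)
  have hx := logGrowth_nonneg x
  have hy := logGrowth_nonneg y
  rcases le_total (‖x - y‖ ^ 2) 1 with h1 | h1
  · refine le_add_right ?_
    rw [sphLogApprox_of_ne hε h, two_mul_sphLog_of_ne h]
    refine ENNReal.ofReal_le_ofReal ?_
    have := (expInt_sub_of_le_one hε (by positivity) h1).2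
    linarith
  · refine le_add_left ?_
    rw [sphLogApprox_of_ne hε h, ← ENNReal.ofReal_add hx hy]
    refine ENNReal.ofReal_le_ofReal ?_
    have h2 := (expInt_sub_of_one_le hε h1).1
    have h3 : 0 ≤ Real.exp (-(‖x - y‖ ^ 2 * ε)) * (Real.log (‖x - y‖ ^ 2)) :=
      mul_nonneg (Real.exp_pos _).le (Real.log_nonneg h1)
    linarith

lemma tendsto_sphLogApprox {ε : ℕ → ℝ} (hε : ∀ m, 0 < ε m) (h0 : Tendsto ε atTop (𝓝 0))
    (x y : ℂ) : Tendsto (fun m => sphLogApprox (ε m) x y) atTop (𝓝 (2 * sphLog x y)) := by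
  rcases eq_or_ne x y with rfl | h
  · simp [sphLog_self, sphLogApprox_self (hε _)]
  have hb : 0 < ‖x - y‖ := norm_pos_iff.2 (sub_ne_zero.2 h)
  simp_rw [sphLogApprox_of_ne (hε _) h, two_mul_sphLog_of_ne h]
  exact ENNReal.tendsto_ofReal ((tendsto_expInt_sub (by positivity) hε h0).add_const _)

/-- The mutual spherical logarithmic energy of two measures. -/
noncomputable def sphEnergy (μ ν : Measure ℂ) : ℝ≥0∞ := ∫⁻ p, sphLog p.1 p.2 ∂(μ.prod ν)

lemma measurable_gaussEnergy (μ ν : Measure ℂ) [SFinite μ] [SFinite ν] :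
    Measurable fun s => gaussEnergy s μ ν := by
  unfold gaussEnergy gaussKernel
  refine Measurable.lintegral_prod_right' (f := fun q : ℝ × (ℂ × ℂ) =>
    ENNReal.ofReal (Real.exp (-q.1 * ‖q.2.1 - q.2.2‖ ^ 2))) ?_
  fun_prop

/-- The energy of a pair of measures for the kernel `gaussTail ε`. -/
noncomputable def gaussTailEnergy (ε : ℝ) (μ ν : Measure ℂ) : ℝ≥0∞ :=
  ∫⁻ s in Set.Ioi ε, ENNReal.ofReal s⁻¹ * gaussEnergy s μ ν

/-- The logarithmic moment of a measure. -/
noncomputable def logMoment (μ : Measure ℂ) : ℝ≥0∞ := ∫⁻ x, ENNReal.ofReal (logGrowth x) ∂μ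

/-- The energy of a pair of measures for the kernel `sphLogApprox ε`. -/
noncomputable def sphEnergyApprox (ε : ℝ) (μ ν : Measure ℂ) : ℝ≥0∞ :=
  ∫⁻ p, sphLogApprox ε p.1 p.2 ∂(μ.prod ν)

lemma lintegral_gaussTail (ε : ℝ) (μ ν : Measure ℂ) [SFinite μ] [SFinite ν] :
    ∫⁻ p, gaussTail ε p.1 p.2 ∂(μ.prod ν) = gaussTailEnergy ε μ ν := by
  unfold gaussTail gaussTailEnergy
  rw [lintegral_lintegral_swap]
  · refine lintegral_congr fun s => ?_
    rw [lintegral_const_mul _ (measurable_gaussKernel s)]; rfl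
  · refine Measurable.aemeasurable ?_
    unfold gaussKernel
    fun_prop

/-- The single-variable terms and the constant in `sphLogApprox` contribute equally to both sides of
the positive definiteness inequality. -/
lemma lintegral_sphLogApprox {ε : ℝ} (hε : 0 < ε) (μ ν : Measure ℂ) [IsProbabilityMeasure μ]
    [IsProbabilityMeasure ν] :
    sphEnergyApprox ε μ ν + ENNReal.ofReal (expInt ε) =
      gaussTailEnergy ε μ ν +
      (logMoment μ + logMoment ν) := by
  have hm := continuous_logGrowth.measurable
  have hm1 : Measurable fun x => ENNReal.ofReal (logGrowth x) := by fun_prop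
  have h1 : ∫⁻ p : ℂ × ℂ, (ENNReal.ofReal (logGrowth p.1) + ENNReal.ofReal (logGrowth p.2))
      ∂(μ.prod ν) = logMoment μ + logMoment ν := by
    rw [lintegral_add_left (by fun_prop)]
    congr 1
    · exact measurePreserving_fst.lintegral_comp hm1
    · exact measurePreserving_snd.lintegral_comp hm1
  rw [sphEnergyApprox, ← h1, ← lintegral_gaussTail, ← lintegral_add_left (measurable_gaussTail ε)]
  simp_rw [← sphLogApprox_add hε]
  rw [lintegral_add_left (measurable_sphLogApprox ε)]
  simp

/-- The part of the positive definiteness defect of the logarithmic kernel that comes from the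
Gaussians with `s > 1`. The subtraction is not truncated, by `two_mul_gaussEnergy_le`. -/
noncomputable def energyDefect (μ ν : Measure ℂ) : ℝ≥0∞ :=
  ∫⁻ s in Set.Ioi (1 : ℝ), ENNReal.ofReal s⁻¹ *
    (gaussEnergy s μ μ + gaussEnergy s ν ν - 2 * gaussEnergy s μ ν)

lemma energyDefect_ne_zero {μ ν : Measure ℂ} [IsProbabilityMeasure μ] [IsProbabilityMeasure ν]
    (h : μ ≠ ν) : energyDefect μ ν ≠ 0 := by
  intro h0
  have m1 := measurable_gaussEnergy μ μ
  have m2 := measurable_gaussEnergy μ ν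
  have m3 := measurable_gaussEnergy ν ν
  rw [energyDefect, lintegral_eq_zero_iff (by fun_prop)] at h0
  have h1 : ∀ᵐ s ∂(volume.restrict (Set.Ioi (1 : ℝ))), False := by
    filter_upwards [h0, ae_restrict_mem measurableSet_Ioi] with s hs hs1
    have hs1' : (1 : ℝ) < s := hs1
    have hs0 : 0 < s := by linarith
    simp only [Pi.zero_apply, mul_eq_zero, ENNReal.ofReal_eq_zero, inv_nonpos, not_le.2 hs0,
      false_or] at hs
    exact h (eq_of_gaussEnergy_eq hs0 μ ν (tsub_eq_zero_iff_le.1 hs))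
  rw [eventually_false_iff_eq_bot, ae_eq_bot, Measure.restrict_eq_zero] at h1
  simp at h1

lemma sphLogApprox_mutual_le {ε : ℝ} (hε : 0 < ε) (hε1 : ε ≤ 1) (μ ν : Measure ℂ)
    [IsProbabilityMeasure μ] [IsProbabilityMeasure ν] :
    2 * sphEnergyApprox ε μ ν + energyDefect μ ν ≤
      sphEnergyApprox ε μ μ + sphEnergyApprox ε ν ν := by
  have m1 := measurable_gaussEnergy μ μ
  have m2 := measurable_gaussEnergy μ ν
  have m3 := measurable_gaussEnergy ν ν
  have key : 2 * gaussTailEnergy ε μ ν + energyDefect μ ν ≤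
      gaussTailEnergy ε μ μ +
      gaussTailEnergy ε ν ν := by
    calc _ ≤ 2 * gaussTailEnergy ε μ ν +
          ∫⁻ s in Set.Ioi ε, ENNReal.ofReal s⁻¹ *
            (gaussEnergy s μ μ + gaussEnergy s ν ν - 2 * gaussEnergy s μ ν) := by
          gcongr
          exact lintegral_mono_set (Set.Ioi_subset_Ioi hε1)
      _ = ∫⁻ s in Set.Ioi ε, (ENNReal.ofReal s⁻¹ * gaussEnergy s μ μ +
            ENNReal.ofReal s⁻¹ * gaussEnergy s ν ν) := by
          rw [gaussTailEnergy, ← lintegral_const_mul _ (by fun_prop),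
            ← lintegral_add_left (by fun_prop)]
          refine setLIntegral_congr_fun measurableSet_Ioi fun s hs => ?_
          rw [mul_left_comm, ← mul_add,
            add_tsub_cancel_of_le (two_mul_gaussEnergy_le (hε.trans hs) μ ν), mul_add]
      _ = _ := lintegral_add_left (by fun_prop) _
  have c : 2 * ENNReal.ofReal (expInt ε) ≠ ⊤ := by finiteness
  rw [← ENNReal.add_le_add_iff_right c]
  calc _ = 2 * (sphEnergyApprox ε μ ν + ENNReal.ofReal (expInt ε))
        + energyDefect μ ν := by ring
    _ = 2 * gaussTailEnergy ε μ ν + energyDefect μ ν +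
        2 * (logMoment μ + logMoment ν) := by
        rw [lintegral_sphLogApprox hε]; ring
    _ ≤ (gaussTailEnergy ε μ μ +
      gaussTailEnergy ε ν ν) +
        2 * (logMoment μ + logMoment ν) := by
        gcongr
    _ = (sphEnergyApprox ε μ μ + ENNReal.ofReal (expInt ε)) +
        (sphEnergyApprox ε ν ν + ENNReal.ofReal (expInt ε)) := by
        rw [lintegral_sphLogApprox hε, lintegral_sphLogApprox hε]; ring
    _ = _ := by ring

/-- Quantitative positive definiteness of the logarithmic kernel. The inequality for the kernels
`sphLogApprox ε` passes to the limit `ε → 0`: the energies of `μ` and `ν` converge by domination,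
and Fatou's lemma controls the mutual energy, which need not be finite beforehand. -/
theorem sphEnergy_mutual_add_defect_le (μ ν : Measure ℂ) [IsProbabilityMeasure μ]
    [IsProbabilityMeasure ν]
    (hμ : logMoment μ ≠ ⊤) (hν : logMoment ν ≠ ⊤) :
    2 * (2 * sphEnergy μ ν) + energyDefect μ ν ≤ 2 * (sphEnergy μ μ + sphEnergy ν ν) := by
  by_cases hμμ : sphEnergy μ μ = ⊤
  · simp [hμμ]
  by_cases hνν : sphEnergy ν ν = ⊤
  · simp [hνν]
  let ε : ℕ → ℝ := fun m => 1 / ((m : ℝ) + 1)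
  have hε : ∀ m, 0 < ε m := fun m => by positivity
  have hε1 : ∀ m, ε m ≤ 1 := fun m => by
    rw [div_le_one (by positivity)]; linarith [(Nat.cast_nonneg m : (0 : ℝ) ≤ m)]
  have h0 : Tendsto ε atTop (𝓝 0) := tendsto_one_div_add_atTop_nhds_zero_nat
  have hm2 : Measurable fun p : ℂ × ℂ => sphLog p.1 p.2 := measurable_sphLog
  have hm := continuous_logGrowth.measurable
  have hm1 : Measurable fun x => ENNReal.ofReal (logGrowth x) := by fun_prop
  have conv : ∀ ρ : Measure ℂ, IsProbabilityMeasure ρ → sphEnergy ρ ρ ≠ ⊤ →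
      logMoment ρ ≠ ⊤ →
      Tendsto (fun m => sphEnergyApprox (ε m) ρ ρ) atTop
        (𝓝 (2 * sphEnergy ρ ρ)) := by
    intro ρ _ h1 h2
    unfold sphEnergyApprox
    rw [sphEnergy, ← lintegral_const_mul _ hm2]
    refine tendsto_lintegral_of_dominated_convergence
      (fun p => 2 * sphLog p.1 p.2 +
        (ENNReal.ofReal (logGrowth p.1) + ENNReal.ofReal (logGrowth p.2)))
      (fun m => measurable_sphLogApprox (ε m))
      (fun m => Eventually.of_forall fun p => sphLogApprox_le (hε m) p.1 p.2) ?_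
      (Eventually.of_forall fun p => tendsto_sphLogApprox hε h0 p.1 p.2)
    rw [lintegral_add_left (by fun_prop), lintegral_add_left (by fun_prop),
      lintegral_const_mul _ hm2, measurePreserving_fst.lintegral_comp hm1,
      measurePreserving_snd.lintegral_comp hm1]
    rw [sphEnergy] at h1
    rw [logMoment] at h2
    finiteness
  have hR := (conv μ inferInstance hμμ hμ).add (conv ν inferInstance hνν hν)
  rw [← mul_add] at hR
  have hfatou : 2 * (2 * sphEnergy μ ν) + energyDefect μ ν ≤
      liminf (fun m => 2 * sphEnergyApprox (ε m) μ ν + energyDefect μ ν) atTop := by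
    have e1 : 2 * (2 * sphEnergy μ ν) + energyDefect μ ν =
        ∫⁻ p, (2 * (2 * sphLog p.1 p.2) + energyDefect μ ν) ∂(μ.prod ν) := by
      rw [lintegral_add_left (by fun_prop), lintegral_const_mul _ (by fun_prop),
        lintegral_const_mul _ hm2]
      simp [sphEnergy]
    have e2 : ∀ m, 2 * sphEnergyApprox (ε m) μ ν + energyDefect μ ν =
        ∫⁻ p, (2 * sphLogApprox (ε m) p.1 p.2 + energyDefect μ ν) ∂(μ.prod ν) := by
      intro m
      have := measurable_sphLogApprox (ε m)
      rw [lintegral_add_left (by fun_prop), lintegral_const_mul _ (by fun_prop)]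
      simp [sphEnergyApprox]
    simp_rw [e1, e2]
    refine le_trans (le_of_eq ?_) (lintegral_liminf_le fun m =>
      ((measurable_sphLogApprox (ε m)).const_mul 2).add_const _)
    refine lintegral_congr fun p => Eq.symm (Tendsto.liminf_eq ?_)
    exact (ENNReal.Tendsto.const_mul (tendsto_sphLogApprox hε h0 p.1 p.2)
      (Or.inr (by simp))).add_const _
  refine hfatou.trans (le_trans (liminf_le_liminf (Eventually.of_forall fun m =>
    sphLogApprox_mutual_le (hε m) (hε1 m) μ ν)) hR.liminf_eq.le)

/-- Positive definiteness of the logarithmic kernel. -/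
theorem two_mul_sphEnergy_le (μ ν : Measure ℂ) [IsProbabilityMeasure μ] [IsProbabilityMeasure ν]
    (hμ : logMoment μ ≠ ⊤) (hν : logMoment ν ≠ ⊤) :
    2 * sphEnergy μ ν ≤ sphEnergy μ μ + sphEnergy ν ν := by
  have h := le_self_add.trans (sphEnergy_mutual_add_defect_le μ ν hμ hν)
  rwa [ENNReal.mul_le_mul_iff_right (by simp) (by simp)] at h

/-- Strict positive definiteness of the logarithmic kernel. -/
theorem two_mul_sphEnergy_lt {μ ν : Measure ℂ} [IsProbabilityMeasure μ] [IsProbabilityMeasure ν]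
    (hμ : logMoment μ ≠ ⊤) (hν : logMoment ν ≠ ⊤) (hμμ : sphEnergy μ μ ≠ ⊤)
    (hνν : sphEnergy ν ν ≠ ⊤) (h : μ ≠ ν) :
    2 * sphEnergy μ ν < sphEnergy μ μ + sphEnergy ν ν := by
  have h1 := sphEnergy_mutual_add_defect_le μ ν hμ hν
  have hfin : 2 * (2 * sphEnergy μ ν) ≠ ⊤ := ne_top_of_le_ne_top (by finiteness)
    (le_self_add.trans h1)
  have h2 := (ENNReal.lt_add_right hfin (energyDefect_ne_zero h)).trans_le h1
  exact lt_of_mul_lt_mul_left' h2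

/-! ### The equilibrium measure -/

/-- The field `W` grows at infinity at least like a positive multiple of `log (1 + |z|²)`. -/
def HasLogGrowth (W : ℂ → ℝ≥0∞) : Prop :=
  ∃ c A : ℝ≥0, c ≠ 0 ∧ ∀ z, c * ENNReal.ofReal (logGrowth z) ≤ W z + A

/-- A field of logarithmic growth tends to infinity. -/
lemma HasLogGrowth.exists_lt {W : ℂ → ℝ≥0∞} (hW : HasLogGrowth W) {t : ℝ≥0∞} (ht : t ≠ ⊤) :
    ∃ R : ℝ, ∀ z, R < ‖z‖ → t < W z := by
  obtain ⟨c, A, hc, h⟩ := hW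
  have hc' : (c : ℝ≥0∞) ≠ 0 := by simpa using hc
  have hfin : (t + A) / c ≠ ⊤ := ENNReal.div_ne_top (by finiteness) hc'
  refine ⟨Real.sqrt (Real.exp ((t + A) / c).toReal), fun z hz => ?_⟩
  by_contra hlt
  rw [not_lt] at hlt
  have h1 : ENNReal.ofReal (logGrowth z) ≤ (t + A) / c := by
    rw [ENNReal.le_div_iff_mul_le (Or.inl hc') (Or.inl (by simp)), mul_comm]
    exact (h z).trans (by gcongr)
  have h2 : logGrowth z ≤ ((t + A) / c).toReal := (ENNReal.ofReal_le_iff_le_toReal hfin).1 h1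
  have h3 := Real.exp_le_exp.2 h2
  rw [exp_logGrowth] at h3
  have h4 := (Real.sqrt_lt' (lt_of_le_of_lt (Real.sqrt_nonneg _) hz)).1 hz
  linarith

lemma HasLogGrowth.logMoment_ne_top {W : ℂ → ℝ≥0∞} (hW : HasLogGrowth W) {μ : Measure ℂ}
    [IsProbabilityMeasure μ] (h : ∫⁻ z, W z ∂μ ≠ ⊤) : logMoment μ ≠ ⊤ := by
  obtain ⟨c, A, hc, hcA⟩ := hW
  have hm := continuous_logGrowth.measurable
  have h1 : c * logMoment μ ≤ ∫⁻ z, W z ∂μ + A := by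
    rw [logMoment, ← lintegral_const_mul _ (by fun_prop)]
    refine (lintegral_mono hcA).trans ?_
    rw [lintegral_add_right _ measurable_const]
    simp
  have h2 : c * logMoment μ ≠ ⊤ := ne_top_of_le_ne_top (by finiteness) h1
  intro h3
  rw [h3, ENNReal.mul_top (by simpa using hc)] at h2
  exact h2 rfl

/-- The weighted energy of a measure for the kernel `fieldKernel W`. -/
noncomputable def fieldEnergy (W : ℂ → ℝ≥0∞) (μ : Measure ℂ) : ℝ≥0∞ :=
  ∫⁻ p, fieldKernel W p.1 p.2 ∂(μ.prod μ)

lemma lintegral_fieldKernel {W : ℂ → ℝ≥0∞} (hW : Measurable W) (μ ν : Measure ℂ)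
    [IsProbabilityMeasure μ] [IsProbabilityMeasure ν] :
    ∫⁻ p, fieldKernel W p.1 p.2 ∂(μ.prod ν) =
      sphEnergy μ ν + (∫⁻ z, W z ∂μ + ∫⁻ z, W z ∂ν) / 2 := by
  unfold fieldKernel
  rw [lintegral_add_left measurable_sphLog]
  simp_rw [div_eq_mul_inv]
  rw [lintegral_mul_const _ (by fun_prop), lintegral_add_left (by fun_prop),
    measurePreserving_fst.lintegral_comp hW, measurePreserving_snd.lintegral_comp hW]
  rfl

lemma fieldEnergy_eq {W : ℂ → ℝ≥0∞} (hW : Measurable W) (μ : Measure ℂ)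
    [IsProbabilityMeasure μ] : fieldEnergy W μ = sphEnergy μ μ + ∫⁻ z, W z ∂μ := by
  rw [fieldEnergy, lintegral_fieldKernel hW, ← two_mul, mul_comm,
    ENNReal.mul_div_cancel_right (by simp) (by simp)]

lemma lintegral_le_fieldEnergy {W : ℂ → ℝ≥0∞} (hW : Measurable W) (μ : Measure ℂ)
    [IsProbabilityMeasure μ] : ∫⁻ z, W z ∂μ ≤ fieldEnergy W μ := by
  rw [fieldEnergy_eq hW]; exact le_add_self

/-- The weighted energy for the kernel `fieldKernel W` truncated at height `M`. -/
noncomputable def fieldEnergyTrunc (W : ℂ → ℝ≥0∞) (M : ℕ) (μ : Measure ℂ) : ℝ≥0∞ :=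
  ∫⁻ p, min (fieldKernel W p.1 p.2) M ∂(μ.prod μ)

lemma continuous_fieldEnergyTrunc {W : ℂ → ℝ≥0∞} (hW : Continuous W) (M : ℕ) :
    Continuous fun μ : ProbabilityMeasure ℂ => fieldEnergyTrunc W M (μ : Measure ℂ) := by
  have hfin : ∀ p : ℂ × ℂ, min (fieldKernel W p.1 p.2) M ≠ ⊤ := fun p =>
    ne_top_of_le_ne_top (ENNReal.natCast_ne_top M) (min_le_right _ _)
  have hcont : Continuous fun p : ℂ × ℂ => (min (fieldKernel W p.1 p.2) M).toNNReal := by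
    refine continuous_iff_continuousAt.2 fun p => ?_
    exact (ENNReal.tendsto_toNNReal (hfin p)).comp
      (((continuous_fieldKernel hW).min continuous_const).tendsto p)
  let f : BoundedContinuousFunction (ℂ × ℂ) ℝ≥0 := BoundedContinuousFunction.mkOfBound
    ⟨_, hcont⟩ M (by
      have hb : ∀ p : ℂ × ℂ, (min (fieldKernel W p.1 p.2) M).toNNReal ≤ (M : ℝ≥0) := fun p => by
        rw [← ENNReal.coe_le_coe, ENNReal.coe_toNNReal (hfin p)]
        exact_mod_cast min_le_right _ _
      intro x y
      rw [NNReal.dist_eq, abs_le]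
      have hx : ((min (fieldKernel W x.1 x.2) M).toNNReal : ℝ) ≤ M := by exact_mod_cast hb x
      have hy : ((min (fieldKernel W y.1 y.2) M).toNNReal : ℝ) ≤ M := by exact_mod_cast hb y
      have hx0 := NNReal.coe_nonneg (min (fieldKernel W x.1 x.2) M).toNNReal
      have hy0 := NNReal.coe_nonneg (min (fieldKernel W y.1 y.2) M).toNNReal
      constructor <;> simp only [ContinuousMap.coe_mk] <;> linarith)
  have hf : ∀ p, ((f p : ℝ≥0) : ℝ≥0∞) = min (fieldKernel W p.1 p.2) M := fun p =>
    ENNReal.coe_toNNReal (hfin p)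
  have hprod : Continuous fun μ : ProbabilityMeasure ℂ => μ.prod μ :=
    ProbabilityMeasure.continuous_prod.comp (continuous_id.prodMk continuous_id)
  refine continuous_iff_continuousAt.2 fun μ => ?_
  have h := ProbabilityMeasure.tendsto_iff_forall_lintegral_tendsto.1 (hprod.tendsto μ) f
  simp_rw [hf] at h
  exact h

lemma iSup_fieldEnergyTrunc {W : ℂ → ℝ≥0∞} (hW : Continuous W) (μ : Measure ℂ) :
    ⨆ M, fieldEnergyTrunc W M μ = fieldEnergy W μ := by
  unfold fieldEnergyTrunc fieldEnergy
  rw [← lintegral_iSup]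
  · refine lintegral_congr fun p => ?_
    rw [← inf_iSup_eq, ENNReal.iSup_natCast, inf_top_eq]
  · exact fun M => ((continuous_fieldKernel hW).min continuous_const).measurable
  · intro a b hab p
    exact min_le_min_left _ (by exact_mod_cast hab)

lemma lowerSemicontinuous_fieldEnergy {W : ℂ → ℝ≥0∞} (hW : Continuous W) :
    LowerSemicontinuous fun μ : ProbabilityMeasure ℂ => fieldEnergy W (μ : Measure ℂ) := by
  simp_rw [← iSup_fieldEnergyTrunc hW]
  exact lowerSemicontinuous_iSup fun M => (continuous_fieldEnergyTrunc hW M).lowerSemicontinuous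

/-- Probability measures that give a uniformly bounded integral to the field form a relatively
compact set. -/
lemma isCompact_closure_setOf_lintegral_le {W : ℂ → ℝ≥0∞} (hW : Measurable W)
    (hgr : HasLogGrowth W) {t : ℝ≥0∞} (ht : t ≠ ⊤) :
    IsCompact (closure {μ : ProbabilityMeasure ℂ | ∫⁻ z, W z ∂(μ : Measure ℂ) ≤ t}) := by
  refine isCompact_closure_of_isTightMeasureSet ?_
  refine isTightMeasureSet_iff_exists_isCompact_measure_compl_le.2 fun ε hε => ?_
  rcases eq_or_ne ε ⊤ with rfl | hε'
  · exact ⟨∅, isCompact_empty, fun _ _ => le_top⟩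
  obtain ⟨R, hR⟩ := hgr.exists_lt (t := t / ε + 1)
    (ENNReal.add_ne_top.2 ⟨ENNReal.div_ne_top ht hε.ne', by simp⟩)
  refine ⟨Metric.closedBall 0 R, isCompact_closedBall 0 R, ?_⟩
  rintro _ ⟨μ, hμ, rfl⟩
  have hs : t / ε + 1 ≠ 0 := by simp
  have hs' : t / ε + 1 ≠ ⊤ := ENNReal.add_ne_top.2 ⟨ENNReal.div_ne_top ht hε.ne', by simp⟩
  calc (μ : Measure ℂ) (Metric.closedBall 0 R)ᶜ ≤ (μ : Measure ℂ) {z | t / ε + 1 ≤ W z} := by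
        refine measure_mono fun z hz => (hR z ?_).le
        simpa using hz
    _ ≤ (∫⁻ z, W z ∂(μ : Measure ℂ)) / (t / ε + 1) :=
        meas_ge_le_lintegral_div hW.aemeasurable hs hs'
    _ ≤ t / (t / ε + 1) := by gcongr; exact hμ
    _ ≤ ε := by
        refine ENNReal.div_le_of_le_mul ?_
        rw [mul_add, ENNReal.mul_div_cancel hε.ne' hε']
        exact le_self_add

lemma sphEnergy_comm (μ ν : Measure ℂ) [SFinite μ] [SFinite ν] :
    sphEnergy μ ν = sphEnergy ν μ := by
  rw [sphEnergy, sphEnergy, ← lintegral_prod_swap]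
  exact lintegral_congr fun p => sphLog_comm _ _

/-- The midpoint of two probability measures. -/
noncomputable def midMeasure (μ ν : Measure ℂ) : Measure ℂ := (2⁻¹ : ℝ≥0∞) • (μ + ν)

instance (μ ν : Measure ℂ) [IsProbabilityMeasure μ] [IsProbabilityMeasure ν] :
    IsProbabilityMeasure (midMeasure μ ν) := by
  constructor
  simp only [midMeasure, Measure.smul_apply, Measure.add_apply, measure_univ, smul_eq_mul]
  rw [one_add_one_eq_two, ENNReal.inv_mul_cancel (by simp) (by simp)]

lemma four_mul_fieldEnergy_midMeasure {W : ℂ → ℝ≥0∞} (hW : Measurable W) (μ ν : Measure ℂ)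
    [IsProbabilityMeasure μ] [IsProbabilityMeasure ν] :
    4 * fieldEnergy W (midMeasure μ ν) =
      sphEnergy μ μ + 2 * sphEnergy μ ν + sphEnergy ν ν + 2 * (∫⁻ z, W z ∂μ + ∫⁻ z, W z ∂ν) := by
  have h2 : (2 : ℝ≥0∞) * 2⁻¹ = 1 := ENNReal.mul_inv_cancel (by simp) (by simp)
  have h1 : sphEnergy (midMeasure μ ν) (midMeasure μ ν) =
      2⁻¹ * (2⁻¹ * (sphEnergy μ μ + 2 * sphEnergy μ ν + sphEnergy ν ν)) := by
    rw [sphEnergy, midMeasure, Measure.prod_smul_left, Measure.prod_smul_right,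
      Measure.prod_add, Measure.add_prod, Measure.add_prod]
    simp only [lintegral_smul_measure, lintegral_add_measure, smul_eq_mul]
    change 2⁻¹ * (2⁻¹ * (sphEnergy μ μ + sphEnergy ν μ + (sphEnergy μ ν + sphEnergy ν ν))) = _
    rw [sphEnergy_comm ν μ]; ring
  rw [fieldEnergy_eq hW, h1, midMeasure, lintegral_smul_measure, lintegral_add_measure, smul_eq_mul]
  calc _ = (2 * 2⁻¹) * (2 * 2⁻¹) * (sphEnergy μ μ + 2 * sphEnergy μ ν + sphEnergy ν ν) +
        (2 * 2⁻¹) * (2 * (∫⁻ z, W z ∂μ + ∫⁻ z, W z ∂ν)) := by ring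
    _ = _ := by rw [h2]; ring

/-- Strict convexity of the weighted energy. -/
lemma two_mul_fieldEnergy_midMeasure_lt {W : ℂ → ℝ≥0∞} (hW : Measurable W) (hgr : HasLogGrowth W)
    {μ ν : Measure ℂ} [IsProbabilityMeasure μ] [IsProbabilityMeasure ν]
    (hμ : fieldEnergy W μ ≠ ⊤) (hν : fieldEnergy W ν ≠ ⊤) (h : μ ≠ ν) :
    2 * fieldEnergy W (midMeasure μ ν) < fieldEnergy W μ + fieldEnergy W ν := by
  rw [fieldEnergy_eq hW] at hμ hν
  obtain ⟨hμ1, hμ2⟩ := ENNReal.add_ne_top.1 hμ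
  obtain ⟨hν1, hν2⟩ := ENNReal.add_ne_top.1 hν
  have h1 := two_mul_sphEnergy_lt (hgr.logMoment_ne_top hμ2) (hgr.logMoment_ne_top hν2) hμ1 hν1 h
  refine lt_of_mul_lt_mul_left' (a := 2) ?_
  calc 2 * (2 * fieldEnergy W (midMeasure μ ν)) = 4 * fieldEnergy W (midMeasure μ ν) := by ring
    _ = 2 * sphEnergy μ ν + (sphEnergy μ μ + sphEnergy ν ν +
          2 * (∫⁻ z, W z ∂μ + ∫⁻ z, W z ∂ν)) := by
        rw [four_mul_fieldEnergy_midMeasure hW]; ring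
    _ < (sphEnergy μ μ + sphEnergy ν ν) + (sphEnergy μ μ + sphEnergy ν ν +
          2 * (∫⁻ z, W z ∂μ + ∫⁻ z, W z ∂ν)) :=
        ENNReal.add_lt_add_right (by finiteness) h1
    _ = 2 * (fieldEnergy W μ + fieldEnergy W ν) := by
        rw [fieldEnergy_eq hW, fieldEnergy_eq hW]; ring

/-- The energy of the normalized restriction of `μ` to `A`. -/
lemma fieldEnergy_cond (W : ℂ → ℝ≥0∞) (μ : Measure ℂ) [IsProbabilityMeasure μ]
    (A : Set ℂ) : fieldEnergy W (ProbabilityTheory.cond μ A) =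
      (μ A)⁻¹ * ((μ A)⁻¹ * ∫⁻ p in A ×ˢ A, fieldKernel W p.1 p.2 ∂(μ.prod μ)) := by
  rw [fieldEnergy, ProbabilityTheory.cond, Measure.prod_smul_left, Measure.prod_smul_right,
    lintegral_smul_measure, lintegral_smul_measure, Measure.prod_restrict, smul_eq_mul, smul_eq_mul]

lemma fieldKernel_ge_left (W : ℂ → ℝ≥0∞) (x y : ℂ) : W x / 2 ≤ fieldKernel W x y := by
  rw [fieldKernel, ENNReal.add_div]
  exact le_add_left le_self_add

/-- A minimizer of the weighted energy lives on every ball outside of which the field exceeds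
`2 (m + 1)`, where `m` is the minimum: conditioning on the ball would decrease the energy. -/
lemma measure_closedBall_eq_one {W : ℂ → ℝ≥0∞} {μ : ProbabilityMeasure ℂ} {R : ℝ}
    (hfin : fieldEnergy W (μ : Measure ℂ) ≠ ⊤)
    (hmin : ∀ ν : ProbabilityMeasure ℂ,
      fieldEnergy W (μ : Measure ℂ) ≤ fieldEnergy W (ν : Measure ℂ))
    (hR : ∀ z, R < ‖z‖ → 2 * (fieldEnergy W (μ : Measure ℂ) + 1) < W z) :
    (μ : Measure ℂ) (Metric.closedBall 0 R) = 1 := by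
  set A : Set ℂ := Metric.closedBall 0 R with hA
  set m := fieldEnergy W (μ : Measure ℂ) with hm
  set p := (μ : Measure ℂ) A with hp
  have hmA : MeasurableSet A := measurableSet_closedBall
  have hp1 : p ≤ 1 := prob_le_one
  have hptop : p ≠ ⊤ := ne_top_of_le_ne_top (by simp) hp1
  have hin : p * (p * m) ≤ ∫⁻ q in A ×ˢ A, fieldKernel W q.1 q.2 ∂((μ : Measure ℂ).prod μ) := by
    rcases eq_or_ne p 0 with h0 | h0
    · simp [h0]
    have : IsProbabilityMeasure (ProbabilityTheory.cond (μ : Measure ℂ) A) :=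
      cond_isProbabilityMeasure h0
    have h1 := hmin ⟨ProbabilityTheory.cond (μ : Measure ℂ) A, this⟩
    simp only [ProbabilityMeasure.coe_mk] at h1
    rw [fieldEnergy_cond, ← hp] at h1
    calc p * (p * m) ≤ p * (p * (p⁻¹ * (p⁻¹ * ∫⁻ q in A ×ˢ A, fieldKernel W q.1 q.2
          ∂((μ : Measure ℂ).prod μ)))) := by gcongr
      _ = (p * p⁻¹) * (p * p⁻¹) * ∫⁻ q in A ×ˢ A, fieldKernel W q.1 q.2
          ∂((μ : Measure ℂ).prod μ) := by ring
      _ = _ := by rw [ENNReal.mul_inv_cancel h0 hptop]; simp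
  -- off `A ×ˢ A`, one of the two points lies in the region where the field exceeds `2 (m + 1)`
  have hout : (m + 1) * (1 - p * p) ≤
      ∫⁻ q in (A ×ˢ A)ᶜ, fieldKernel W q.1 q.2 ∂((μ : Measure ℂ).prod μ) := by
    have h1 : ((μ : Measure ℂ).prod μ) (A ×ˢ A)ᶜ = 1 - p * p := by
      rw [prob_compl_eq_one_sub (hmA.prod hmA), Measure.prod_prod]
    rw [← h1, ← setLIntegral_const]
    refine setLIntegral_mono' (hmA.prod hmA).compl fun q hq => ?_
    have h2 : ∀ z w : ℂ, z ∉ A → m + 1 ≤ fieldKernel W z w := by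
      intro z w hz
      refine le_trans ?_ (fieldKernel_ge_left W z w)
      rw [ENNReal.le_div_iff_mul_le (Or.inl (by simp)) (Or.inl (by simp)), mul_comm]
      refine (hR z ?_).le
      simpa [hA] using hz
    by_cases hq1 : q.1 ∈ A
    · rw [fieldKernel_comm]
      exact h2 _ _ fun hq2 => hq ⟨hq1, hq2⟩
    · exact h2 _ _ hq1
  -- hence `p² m + (m + 1) (1 - p²) ≤ m`, which forces `p = 1`
  have htot : p * (p * m) + (m + 1) * (1 - p * p) ≤ m := by
    conv_rhs => rw [hm, fieldEnergy, ← lintegral_add_compl _ (hmA.prod hmA)]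
    exact add_le_add hin hout
  have hpp : p * p ≤ 1 := mul_le_one' hp1 hp1
  have h3 : m + (1 - p * p) ≤ m + 0 := by
    calc m + (1 - p * p) = (p * p + (1 - p * p)) * m + (1 - p * p) := by
          rw [add_tsub_cancel_of_le hpp, one_mul]
      _ = p * (p * m) + (m + 1) * (1 - p * p) := by ring
      _ ≤ m + 0 := by simpa using htot
  have h4 := (ENNReal.add_le_add_iff_left hfin).1 h3
  have h5 : 1 ≤ p * p := tsub_eq_zero_iff_le.1 (le_antisymm h4 bot_le)
  refine le_antisymm hp1 (h5.trans ?_)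
  exact mul_le_of_le_one_left' hp1

/-- Existence, uniqueness and compactness of the support of the equilibrium measure. Existence is
lower semicontinuity of the energy on a relatively compact set, uniqueness is strict convexity. -/
theorem exists_equilibrium_measure {W : ℂ → ℝ≥0∞} (hW : Continuous W) (hgr : HasLogGrowth W)
    (h0 : ∃ μ : ProbabilityMeasure ℂ, fieldEnergy W (μ : Measure ℂ) ≠ ⊤) :
    ∃ μ : ProbabilityMeasure ℂ, fieldEnergy W (μ : Measure ℂ) ≠ ⊤ ∧
      IsCompact (μ : Measure ℂ).support ∧
      ∀ ν : ProbabilityMeasure ℂ, ν ≠ μ →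
        fieldEnergy W (μ : Measure ℂ) < fieldEnergy W (ν : Measure ℂ) := by
  obtain ⟨μ₀, hμ₀⟩ := h0
  set K := closure {μ : ProbabilityMeasure ℂ |
    ∫⁻ z, W z ∂(μ : Measure ℂ) ≤ fieldEnergy W (μ₀ : Measure ℂ)} with hK
  have hKc : IsCompact K := isCompact_closure_setOf_lintegral_le hW.measurable hgr hμ₀
  have hmem : ∀ ν : ProbabilityMeasure ℂ,
      fieldEnergy W (ν : Measure ℂ) ≤ fieldEnergy W (μ₀ : Measure ℂ) → ν ∈ K := fun ν hν =>
    subset_closure ((lintegral_le_fieldEnergy hW.measurable _).trans hν)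
  obtain ⟨μ, hμK, hμmin⟩ := LowerSemicontinuousOn.exists_isMinOn ⟨μ₀, hmem μ₀ le_rfl⟩ hKc
    ((lowerSemicontinuous_fieldEnergy hW).lowerSemicontinuousOn K)
  have hmin : ∀ ν : ProbabilityMeasure ℂ,
      fieldEnergy W (μ : Measure ℂ) ≤ fieldEnergy W (ν : Measure ℂ) := by
    intro ν
    rcases le_total (fieldEnergy W (ν : Measure ℂ)) (fieldEnergy W (μ₀ : Measure ℂ)) with h | h
    · exact hμmin (hmem ν h)
    · exact le_trans (hμmin (hmem μ₀ le_rfl)) h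
  have hfin : fieldEnergy W (μ : Measure ℂ) ≠ ⊤ := ne_top_of_le_ne_top hμ₀ (hmin μ₀)
  refine ⟨μ, hfin, ?_, fun ν hν => lt_of_le_of_ne (hmin ν) fun heq => ?_⟩
  · obtain ⟨R, hR⟩ := hgr.exists_lt (t := 2 * (fieldEnergy W (μ : Measure ℂ) + 1))
      (by finiteness)
    have h1 := measure_closedBall_eq_one hfin hmin hR
    refine (isCompact_closedBall (0 : ℂ) R).of_isClosed_subset Measure.isClosed_support ?_
    refine Measure.support_subset_of_isClosed Metric.isClosed_closedBall ?_
    rw [mem_ae_iff, prob_compl_eq_zero_iff measurableSet_closedBall]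
    exact h1
  · have hne : (μ : Measure ℂ) ≠ ν := fun h => hν (Subtype.ext h.symm)
    have h1 := two_mul_fieldEnergy_midMeasure_lt hW.measurable hgr hfin (heq ▸ hfin) hne
    have h2 := hmin ⟨midMeasure μ ν, inferInstance⟩
    rw [← heq, ← two_mul] at h1
    exact absurd (lt_of_mul_lt_mul_left' h1) (not_lt.2 h2)

/-! ### Regularization of measures -/

/-- Conditioning on a high sublevel set of the field hardly increases the energy. -/
lemma exists_fieldEnergy_sublevel_le {W : ℂ → ℝ≥0∞} (hW : Continuous W) (μ : Measure ℂ)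
    [IsProbabilityMeasure μ] (hfin : fieldEnergy W μ ≠ ⊤) {ε : ℝ≥0∞} (hε : ε ≠ 0) :
    ∃ (n : ℕ) (ν : Measure ℂ), IsProbabilityMeasure ν ∧ ν {z | W z ≤ n}ᶜ = 0 ∧
      fieldEnergy W ν ≤ fieldEnergy W μ + ε := by
  let K : ℕ → Set ℂ := fun n => {z | W z ≤ n}
  have hK : ∀ n, MeasurableSet (K n) := fun n => measurableSet_le hW.measurable measurable_const
  have hmono : Monotone K := fun a b hab z (hz : W z ≤ a) =>
    hz.trans (by exact_mod_cast hab)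
  have hlim : Tendsto (fun n => μ (K n)) atTop (𝓝 1) := by
    have h1 := tendsto_measure_iUnion_atTop (μ := μ) hmono
    have h2 : μ (⋃ n, K n) = 1 := by
      refine (prob_compl_eq_zero_iff (MeasurableSet.iUnion hK)).1 (mem_ae_iff.1 ?_)
      have h3 := ae_lt_top hW.measurable
        (ne_top_of_le_ne_top hfin (lintegral_le_fieldEnergy hW.measurable μ))
      filter_upwards [h3] with z hz
      obtain ⟨n, hn⟩ := ENNReal.exists_nat_gt hz.ne
      exact Set.mem_iUnion.2 ⟨n, hn.le⟩
    rwa [h2] at h1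
  have hlim2 : Tendsto (fun n => (μ (K n))⁻¹ * ((μ (K n))⁻¹ * fieldEnergy W μ)) atTop
      (𝓝 (1⁻¹ * (1⁻¹ * fieldEnergy W μ))) := by
    have h1 : Tendsto (fun n => (μ (K n))⁻¹) atTop (𝓝 1⁻¹) := tendsto_inv_iff.2 hlim
    have h2 := ENNReal.Tendsto.mul_const (b := fieldEnergy W μ) h1 (Or.inr hfin)
    exact ENNReal.Tendsto.mul h1 (Or.inl (by simp)) h2 (Or.inr (by simp))
  have h0 : ∀ᶠ n in atTop, (0 : ℝ≥0∞) < μ (K n) := hlim.eventually_const_lt (by simp)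
  have h1 : ∀ᶠ n in atTop, (μ (K n))⁻¹ * ((μ (K n))⁻¹ * fieldEnergy W μ) < fieldEnergy W μ + ε :=
    hlim2.eventually_lt_const (by simpa using ENNReal.lt_add_right hfin hε)
  obtain ⟨n, hn0, hn1⟩ := (h0.and h1).exists
  refine ⟨n, ProbabilityTheory.cond μ (K n), cond_isProbabilityMeasure hn0.ne', ?_, ?_⟩
  · rw [cond_apply (hK n)]
    simp [K]
  · rw [fieldEnergy_cond]
    refine le_trans ?_ hn1.le
    gcongr
    exact setLIntegral_le_lintegral _ _

/-- `log (1 + |z|²)` is Lipschitz. -/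
lemma logGrowth_add_le (x v : ℂ) : logGrowth (v + x) ≤ logGrowth x + 2 * ‖v‖ := by
  rw [logGrowth, Real.log_le_iff_le_exp (by positivity), Real.exp_add, exp_logGrowth]
  have h1 : ‖v + x‖ ≤ ‖v‖ + ‖x‖ := norm_add_le v x
  have h2 := Real.quadratic_le_exp_of_nonneg (x := 2 * ‖v‖) (by positivity)
  have h3 : 1 + ‖v + x‖ ^ 2 ≤ (1 + ‖x‖ ^ 2) * (1 + 2 * ‖v‖ + (2 * ‖v‖) ^ 2 / 2) := by
    have : ‖v + x‖ ^ 2 ≤ (‖v‖ + ‖x‖) ^ 2 := by gcongr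
    nlinarith [norm_nonneg v, norm_nonneg x, mul_nonneg (norm_nonneg v) (sq_nonneg (1 - ‖x‖)),
      mul_nonneg (sq_nonneg ‖v‖) (sq_nonneg ‖x‖)]
  exact h3.trans (by gcongr)

lemma sphLog_add_le (x y v : ℂ) :
    sphLog (v + x) (v + y) ≤ sphLog x y + ENNReal.ofReal (2 * ‖v‖) := by
  rcases eq_or_ne x y with rfl | h
  · simp [sphLog_self]
  have h' : v + x ≠ v + y := fun h2 => h (add_left_cancel h2)
  have h3 := log_norm_sub_le h
  rw [sphLog_of_ne h, sphLog_of_ne h', ← ENNReal.ofReal_add (by linarith) (by positivity)]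
  refine ENNReal.ofReal_le_ofReal ?_
  rw [add_sub_add_left_eq_sub]
  have := logGrowth_add_le x v
  have := logGrowth_add_le y v
  linarith

/-- The translate of a measure by `v`. -/
noncomputable def translate (μ : Measure ℂ) (v : ℂ) : Measure ℂ := μ.map (v + ·)

instance (μ : Measure ℂ) [IsProbabilityMeasure μ] (v : ℂ) : IsProbabilityMeasure (translate μ v) :=
  Measure.isProbabilityMeasure_map (by fun_prop)

lemma lintegral_translate (μ : Measure ℂ) (v : ℂ) {f : ℂ → ℝ≥0∞} (hf : Measurable f) :
    ∫⁻ x, f x ∂(translate μ v) = ∫⁻ x, f (v + x) ∂μ :=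
  lintegral_map hf (by fun_prop)

lemma sphEnergy_translate (μ : Measure ℂ) [IsProbabilityMeasure μ] (v w : ℂ) :
    sphEnergy (translate μ v) (translate μ w) = ∫⁻ x, ∫⁻ y, sphLog (v + x) (w + y) ∂μ ∂μ := by
  have hm := measurable_sphLog
  rw [sphEnergy, lintegral_prod _ hm.aemeasurable, lintegral_translate μ v hm.lintegral_prod_right']
  refine lintegral_congr fun x => ?_
  exact lintegral_translate μ w (f := sphLog (v + x)) (measurable_sphLog_left _)

lemma sphEnergy_translate_self_le (μ : Measure ℂ) [IsProbabilityMeasure μ] (v : ℂ) :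
    sphEnergy (translate μ v) (translate μ v) ≤ sphEnergy μ μ + ENNReal.ofReal (2 * ‖v‖) := by
  have hm := measurable_sphLog
  calc sphEnergy (translate μ v) (translate μ v)
      = ∫⁻ x, ∫⁻ y, sphLog (v + x) (v + y) ∂μ ∂μ := sphEnergy_translate μ v v
    _ ≤ ∫⁻ x, ∫⁻ y, (sphLog x y + ENNReal.ofReal (2 * ‖v‖)) ∂μ ∂μ :=
        lintegral_mono fun x => lintegral_mono fun y => sphLog_add_le x y v
    _ = sphEnergy μ μ + ENNReal.ofReal (2 * ‖v‖) := by
        rw [sphEnergy, lintegral_prod _ hm.aemeasurable]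
        simp_rw [lintegral_add_right _ measurable_const]
        simp

lemma logMoment_translate_ne_top {μ : Measure ℂ} [IsProbabilityMeasure μ] (h : logMoment μ ≠ ⊤)
    (v : ℂ) : logMoment (translate μ v) ≠ ⊤ := by
  have hm := continuous_logGrowth.measurable
  have h1 : logMoment (translate μ v) ≤ logMoment μ + ENNReal.ofReal (2 * ‖v‖) := by
    rw [logMoment, lintegral_translate μ v (by fun_prop)]
    calc _ ≤ ∫⁻ x, (ENNReal.ofReal (logGrowth x) + ENNReal.ofReal (2 * ‖v‖)) ∂μ := by
          refine lintegral_mono fun x => ?_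
          rw [← ENNReal.ofReal_add (logGrowth_nonneg x) (by positivity)]
          exact ENNReal.ofReal_le_ofReal (logGrowth_add_le x v)
      _ = _ := by rw [lintegral_add_right _ measurable_const]; simp [logMoment]
  exact ne_top_of_le_ne_top (by finiteness) h1

/-- By positive definiteness, the energy of a mixture of translates is at most the supremum of the
energies of the translates. -/
lemma sphEnergy_conv_le {μ σ : Measure ℂ} [IsProbabilityMeasure μ] [IsProbabilityMeasure σ]
    (hμ : logMoment μ ≠ ⊤) {r : ℝ} (hσ : ∀ᵐ v ∂σ, ‖v‖ ≤ r) :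
    sphEnergy (σ.conv μ) (σ.conv μ) ≤ sphEnergy μ μ + ENNReal.ofReal (2 * r) := by
  have hm := measurable_sphLog
  have hmx : ∀ v : ℂ, Measurable fun q : (ℂ × ℂ) × ℂ => sphLog (v + q.1.1) (q.1.2 + q.2) := by
    intro v
    exact hm.comp (g := fun p : ℂ × ℂ => sphLog p.1 p.2)
      (f := fun q : (ℂ × ℂ) × ℂ => (v + q.1.1, q.1.2 + q.2)) (by fun_prop)
  have hpair : ∀ v w : ℂ, ‖v‖ ≤ r → ‖w‖ ≤ r →
      sphEnergy (translate μ v) (translate μ w) ≤ sphEnergy μ μ + ENNReal.ofReal (2 * r) := by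
    intro v w hv hw
    have h1 := two_mul_sphEnergy_le _ _ (logMoment_translate_ne_top hμ v)
      (logMoment_translate_ne_top hμ w)
    have h2 : ∀ u : ℂ, ‖u‖ ≤ r → sphEnergy (translate μ u) (translate μ u) ≤
        sphEnergy μ μ + ENNReal.ofReal (2 * r) := fun u hu =>
      (sphEnergy_translate_self_le μ u).trans (by gcongr)
    have h3 := h1.trans (add_le_add (h2 v hv) (h2 w hw))
    rwa [← two_mul, ENNReal.mul_le_mul_iff_right (by simp) (by simp)] at h3
  have h1 : sphEnergy (σ.conv μ) (σ.conv μ) =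
      ∫⁻ v, ∫⁻ w, sphEnergy (translate μ v) (translate μ w) ∂σ ∂σ := by
    rw [sphEnergy, lintegral_prod _ hm.aemeasurable,
      Measure.lintegral_conv hm.lintegral_prod_right']
    refine lintegral_congr fun v => ?_
    have h2 : ∀ x : ℂ, ∫⁻ y, sphLog (v + x) y ∂(σ.conv μ) =
        ∫⁻ w, ∫⁻ y, sphLog (v + x) (w + y) ∂μ ∂σ := fun x =>
      Measure.lintegral_conv (measurable_sphLog_left _)
    simp_rw [h2, sphEnergy_translate]
    have h3 : Measurable fun q : ℂ × ℂ => ∫⁻ y, sphLog (v + q.1) (q.2 + y) ∂μ :=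
      (hmx v).lintegral_prod_right'
    exact lintegral_lintegral_swap (f := fun x w => ∫⁻ y, sphLog (v + x) (w + y) ∂μ)
      h3.aemeasurable
  rw [h1]
  calc _ ≤ ∫⁻ _, ∫⁻ _, (sphEnergy μ μ + ENNReal.ofReal (2 * r)) ∂σ ∂σ := by
        refine lintegral_mono_ae ?_
        filter_upwards [hσ] with v hv
        refine lintegral_mono_ae ?_
        filter_upwards [hσ] with w hw
        exact hpair v w hv hw
    _ = _ := by simp

/-- A continuous field increases by little under small translations of a compact set on which it is
finite. -/
lemma exists_forall_add_le {W : ℂ → ℝ≥0∞} (hW : Continuous W) {K : Set ℂ} (hK : IsCompact K)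
    (hfin : ∀ z ∈ K, W z ≠ ⊤) {ε : ℝ≥0∞} (hε : ε ≠ 0) :
    ∃ r > 0, ∀ x ∈ K, ∀ v : ℂ, ‖v‖ ≤ r → W (v + x) ≤ W x + ε := by
  have hopen : IsOpen {p : ℂ × ℂ | W (p.2 + p.1) < W p.1 + ε} :=
    isOpen_lt (by fun_prop) ((hW.comp continuous_fst).add continuous_const)
  obtain ⟨U, V, -, hV, hKU, h0V, hUV⟩ := generalized_tube_lemma hK
    (isCompact_singleton (x := (0 : ℂ)))
    hopen (by
      rintro ⟨x, v⟩ ⟨hx, hv⟩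
      rw [Set.mem_singleton_iff] at hv
      simp only at hv hx
      simpa [hv] using ENNReal.lt_add_right (hfin x hx) hε)
  obtain ⟨r, hr, hrV⟩ := Metric.isOpen_iff.1 hV 0 (h0V rfl)
  refine ⟨r / 2, by positivity, fun x hx v hv => ?_⟩
  have : (x, v) ∈ U ×ˢ V := ⟨hKU hx, hrV (by rw [mem_ball_zero_iff]; linarith)⟩
  exact (hUV this).le

/-- Convolution with a probability measure preserves a bound on the density. -/
lemma conv_le_smul_volume {σ μ : Measure ℂ} [SFinite σ] [IsProbabilityMeasure μ] {M : ℝ≥0∞}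
    (hσ : σ ≤ M • volume) : σ.conv μ ≤ M • (volume : Measure ℂ) := by
  refine Measure.le_iff.2 fun s hs => ?_
  have hm : Measurable fun p : ℂ × ℂ => s.indicator (1 : ℂ → ℝ≥0∞) (p.1 + p.2) :=
    (measurable_one.indicator hs).comp (by fun_prop)
  rw [← lintegral_indicator_one hs, Measure.lintegral_conv (measurable_one.indicator hs)]
  calc _ ≤ ∫⁻ v, ∫⁻ x, s.indicator 1 (v + x) ∂μ ∂(M • (volume : Measure ℂ)) :=
        lintegral_mono' hσ le_rfl
    _ = M * ∫⁻ x, (∫⁻ v, s.indicator 1 (v + x)) ∂μ := by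
        rw [lintegral_smul_measure, smul_eq_mul, lintegral_lintegral_swap hm.aemeasurable]
    _ = (M • (volume : Measure ℂ)) s := by
        simp_rw [lintegral_add_right_eq_self (s.indicator (1 : ℂ → ℝ≥0∞))]
        simp [lintegral_indicator_one hs]

lemma lintegral_Icc_logInv_lt_top (R : ℝ) :
    ∫⁻ t in Set.Icc (-R) R, (-ENNReal.log ‖2 * t‖ₑ).toENNReal < ⊤ := by
  have h1 : IntegrableOn (fun t : ℝ => Real.log (2 * t)) (Set.Icc (-R) R) := by
    rcases lt_or_ge R 0 with hR | hR
    · rw [Set.Icc_eq_empty (by linarith)]; simp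
    have h2 : IntervalIntegrable (fun t : ℝ => Real.log (2 * t)) volume (-R) R := by
      have h3 : IntervalIntegrable Real.log volume (2 * -R) (2 * R) :=
        intervalIntegral.intervalIntegrable_log'
      have := h3.comp_mul_left (c := 2)
      simpa [neg_div] using this
    rw [intervalIntegrable_iff_integrableOn_Icc_of_le (by linarith)] at h2
    exact h2
  refine lt_of_le_of_lt (lintegral_mono_ae ?_) h1.2
  have h0 : ∀ᵐ t : ℝ ∂(volume.restrict (Set.Icc (-R) R)), t ≠ 0 :=
    ae_restrict_of_ae (Measure.ae_ne volume 0)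
  filter_upwards [h0] with t ht
  have hpos : 0 < ‖2 * t‖ := by simpa using ht
  rw [← ofReal_norm, ENNReal.log_ofReal_of_pos hpos, ← EReal.coe_neg,
    EReal.toENNReal_of_ne_top (EReal.coe_ne_top _), EReal.toReal_coe, ← ofReal_norm]
  refine ENNReal.ofReal_le_ofReal ?_
  rw [Real.norm_eq_abs, Real.norm_eq_abs, Real.log_abs]
  exact neg_le_abs _

/-- The singularity of `log |z - conj z|⁻¹ = log |2 Im z|⁻¹` along the real axis is locally
integrable. -/
lemma setLIntegral_logInv_conj_lt_top (R : ℝ) :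
    ∫⁻ z in Metric.closedBall (0 : ℂ) R, (logInv z (conj z)).toENNReal < ⊤ := by
  have hf : ∀ z : ℂ, (logInv z (conj z)).toENNReal = (-ENNReal.log ‖2 * z.im‖ₑ).toENNReal := by
    intro z
    rw [logInv, ← ofReal_norm, ← ofReal_norm, Complex.sub_conj]
    simp
  let f : ℝ → ℝ≥0∞ := fun t => (-ENNReal.log ‖2 * t‖ₑ).toENNReal
  have hfm : Measurable f := (Continuous.ereal_toENNReal (Continuous.neg
    (ENNReal.continuous_log.comp (by fun_prop)))).measurable
  let B : Set (ℝ × ℝ) := Set.Icc (-R) R ×ˢ Set.Icc (-R) R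
  have hB : MeasurableSet B := measurableSet_Icc.prod measurableSet_Icc
  calc ∫⁻ z in Metric.closedBall (0 : ℂ) R, (logInv z (conj z)).toENNReal
      = ∫⁻ z in Metric.closedBall (0 : ℂ) R, f z.im := lintegral_congr hf
    _ ≤ ∫⁻ z in Complex.measurableEquivRealProd ⁻¹' B, f z.im := by
        refine lintegral_mono_set fun z hz => ?_
        rw [mem_closedBall_zero_iff] at hz
        have h1 := (Complex.abs_re_le_norm z).trans hz
        have h2 := (Complex.abs_im_le_norm z).trans hz
        exact ⟨abs_le.1 h1, abs_le.1 h2⟩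
    _ = ∫⁻ p in B, f p.2 := by
        exact Complex.volume_preserving_equiv_real_prod.setLIntegral_comp_preimage hB
          (f := fun p : ℝ × ℝ => f p.2) (by fun_prop)
    _ = volume (Set.Icc (-R) R) * ∫⁻ t in Set.Icc (-R) R, f t := by
        have h1 : (volume : Measure (ℝ × ℝ)).restrict B =
            (volume.restrict (Set.Icc (-R) R)).prod (volume.restrict (Set.Icc (-R) R)) :=
          (Measure.prod_restrict _ _).symm
        rw [h1, lintegral_prod _ (by fun_prop)]
        simp [mul_comm]
    _ < ⊤ := ENNReal.mul_lt_top (by simp) (lintegral_Icc_logInv_lt_top R)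

lemma sphLog_conj_self_le (z : ℂ) :
    sphLog z (conj z) ≤ (logInv z (conj z)).toENNReal + ENNReal.ofReal (logGrowth z) := by
  have h := coe_sphLog z (conj z)
  rw [logGrowth_conj, add_self_div_two] at h
  have h2 := congrArg EReal.toENNReal h
  rw [EReal.toENNReal_coe] at h2
  rw [h2]
  refine EReal.toENNReal_add_le.trans ?_
  rw [EReal.toENNReal_of_ne_top (EReal.coe_ne_top _), EReal.toReal_coe]

/-! ### Measures of bounded density and Jensen's inequality -/

/-- Measures with bounded density and bounded support approximate the energy of any measure from
above; for these measures, the interaction of a point with its own conjugate is integrable. They are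
obtained by conditioning `μ` on a sublevel set of the field, which is compact, and convolving with
the uniform distribution on a small disc. -/
theorem exists_bounded_density {W : ℂ → ℝ≥0∞} (hW : Continuous W) (hgr : HasLogGrowth W)
    (hconj : ∀ z, W (conj z) = W z) (μ : Measure ℂ) [IsProbabilityMeasure μ]
    (hfin : fieldEnergy W μ ≠ ⊤) {ε : ℝ} (hε : 0 < ε) :
    ∃ (ν : Measure ℂ) (M : ℝ≥0), IsProbabilityMeasure ν ∧ ν ≤ (M : ℝ≥0∞) • volume ∧
      fieldEnergy W ν ≤ fieldEnergy W μ + ENNReal.ofReal ε ∧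
      ∫⁻ z, fieldKernel W z (conj z) ∂ν ≠ ⊤ := by
  obtain ⟨n, μ₁, hμ₁, hK0, hF1⟩ := exists_fieldEnergy_sublevel_le hW μ hfin
    (ε := ENNReal.ofReal (ε / 2)) (by simpa using hε)
  set K : Set ℂ := {z | W z ≤ n} with hKdef
  obtain ⟨R, hR⟩ := hgr.exists_lt (t := n) (by simp)
  have hKR : ∀ z ∈ K, ‖z‖ ≤ R := fun z hz => by
    by_contra h
    exact absurd (hR z (not_le.1 h)) (not_lt.2 hz)
  have hKc : IsCompact K := by
    refine (isCompact_closedBall (0 : ℂ) R).of_isClosed_subset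
      (isClosed_le hW continuous_const) fun z hz => ?_
    rw [mem_closedBall_zero_iff]
    exact hKR z hz
  obtain ⟨r₀, hr₀, hr₀W⟩ := exists_forall_add_le hW hKc
    (fun z hz => ne_top_of_le_ne_top (by simp) hz) (ε := ENNReal.ofReal (ε / 4))
    (by simpa using hε)
  set r := min r₀ (ε / 8) with hrdef
  have hr : 0 < r := lt_min hr₀ (by positivity)
  set σ : Measure ℂ := ProbabilityTheory.cond volume (Metric.ball (0 : ℂ) r) with hσdef
  have hvol0 : (volume : Measure ℂ) (Metric.ball (0 : ℂ) r) ≠ 0 :=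
    (Metric.measure_ball_pos _ _ hr).ne'
  have hvol1 : (volume : Measure ℂ) (Metric.ball (0 : ℂ) r) ≠ ⊤ := measure_ball_lt_top.ne
  have hσ : IsProbabilityMeasure σ := cond_isProbabilityMeasure_of_finite hvol0 hvol1
  have hσr : ∀ᵐ v ∂σ, ‖v‖ ≤ r := by
    refine (Measure.ae_smul_measure (ae_restrict_mem measurableSet_ball) _).mono fun v hv => ?_
    exact (mem_ball_zero_iff.1 hv).le
  have hμ₁K : ∀ᵐ x ∂μ₁, x ∈ K := hK0
  have hF1fin : fieldEnergy W μ₁ ≠ ⊤ := ne_top_of_le_ne_top (by finiteness) hF1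
  have hW1fin : ∫⁻ z, W z ∂μ₁ ≠ ⊤ :=
    ne_top_of_le_ne_top hF1fin (lintegral_le_fieldEnergy hW.measurable μ₁)
  have hlog1 := hgr.logMoment_ne_top hW1fin
  set M := (volume (Metric.ball (0 : ℂ) r))⁻¹ with hM
  have hMtop : M ≠ ⊤ := ENNReal.inv_ne_top.2 hvol0
  have hσM : σ ≤ M • volume := by
    rw [hσdef, ProbabilityTheory.cond, ← hM]
    refine Measure.le_iff.2 fun s _ => ?_
    simp only [Measure.smul_apply, smul_eq_mul]
    gcongr
    exact Measure.restrict_le_self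
  have hνM : σ.conv μ₁ ≤ M • volume := conv_le_smul_volume hσM
  have hWν : ∫⁻ z, W z ∂(σ.conv μ₁) ≤ ∫⁻ z, W z ∂μ₁ + ENNReal.ofReal (ε / 4) := by
    rw [Measure.lintegral_conv hW.measurable]
    calc _ ≤ ∫⁻ _, ∫⁻ x, (W x + ENNReal.ofReal (ε / 4)) ∂μ₁ ∂σ := by
          refine lintegral_mono_ae ?_
          filter_upwards [hσr] with v hv
          refine lintegral_mono_ae ?_
          filter_upwards [hμ₁K] with x hx
          exact hr₀W x hx v (hv.trans (min_le_left _ _))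
      _ = _ := by rw [lintegral_add_right _ measurable_const]; simp
  have hFν : fieldEnergy W (σ.conv μ₁) ≤ fieldEnergy W μ + ENNReal.ofReal ε := by
    rw [fieldEnergy_eq hW.measurable]
    calc _ ≤ (sphEnergy μ₁ μ₁ + ENNReal.ofReal (ε / 4)) +
          (∫⁻ z, W z ∂μ₁ + ENNReal.ofReal (ε / 4)) := by
          refine add_le_add ((sphEnergy_conv_le hlog1 hσr).trans ?_) hWν
          gcongr
          have := min_le_right r₀ (ε / 8)
          linarith
      _ = fieldEnergy W μ₁ + ENNReal.ofReal (ε / 2) := by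
          rw [fieldEnergy_eq hW.measurable, show ε / 2 = ε / 4 + ε / 4 by ring,
            ENNReal.ofReal_add (by positivity) (by positivity)]
          ring
      _ ≤ fieldEnergy W μ + ENNReal.ofReal (ε / 2) + ENNReal.ofReal (ε / 2) := by gcongr
      _ = _ := by
          rw [add_assoc, ← ENNReal.ofReal_add (by positivity) (by positivity), add_halves]
  have hbdd : ∀ᵐ z ∂(σ.conv μ₁), z ∈ Metric.closedBall (0 : ℂ) (r + R) := by
    rw [Measure.conv]
    refine (ae_map_iff (p := fun z => z ∈ Metric.closedBall (0 : ℂ) (r + R)) (by fun_prop)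
      measurableSet_closedBall).2 ?_
    have h1 : ∀ᵐ p ∂(σ.prod μ₁), ‖p.1‖ ≤ r := measurePreserving_fst.quasiMeasurePreserving.ae hσr
    have h2 : ∀ᵐ p ∂(σ.prod μ₁), p.2 ∈ K := measurePreserving_snd.quasiMeasurePreserving.ae hμ₁K
    filter_upwards [h1, h2] with p hp1 hp2
    rw [mem_closedBall_zero_iff]
    exact (norm_add_le _ _).trans (add_le_add hp1 (hKR _ hp2))
  have hWνfin : ∫⁻ z, W z ∂(σ.conv μ₁) ≠ ⊤ := ne_top_of_le_ne_top (by finiteness) hWν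
  refine ⟨σ.conv μ₁, M.toNNReal, inferInstance, ?_, hFν, ?_⟩
  · rwa [ENNReal.coe_toNNReal hMtop]
  · have hlog := hgr.logMoment_ne_top hWνfin
    have h1 : ∫⁻ z, (logInv z (conj z)).toENNReal ∂(σ.conv μ₁) ≠ ⊤ := by
      rw [← Measure.restrict_eq_self_of_ae_mem hbdd]
      refine ne_top_of_le_ne_top (b := M * ∫⁻ z in Metric.closedBall (0 : ℂ) (r + R),
        (logInv z (conj z)).toENNReal)
        (ENNReal.mul_ne_top hMtop (setLIntegral_logInv_conj_lt_top _).ne) ?_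
      rw [← smul_eq_mul, ← lintegral_smul_measure, ← Measure.restrict_smul]
      exact lintegral_mono' (Measure.restrict_mono subset_rfl hνM) le_rfl
    have h2 : ∀ z, fieldKernel W z (conj z) ≤
        (logInv z (conj z)).toENNReal + (ENNReal.ofReal (logGrowth z) + W z) := by
      intro z
      rw [fieldKernel, hconj, ← two_mul, mul_comm, ENNReal.mul_div_cancel_right (by simp) (by simp),
        ← add_assoc]
      gcongr
      exact sphLog_conj_self_le z
    refine ne_top_of_le_ne_top ?_ (lintegral_mono h2)
    have hm := continuous_logGrowth.measurable
    have hWm := hW.measurable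
    rw [lintegral_add_right _ (by fun_prop), lintegral_add_right _ hWm]
    rw [logMoment] at hlog
    finiteness

/-- Product measures depend monotonically on their factors. -/
lemma pi_mono_measure {ι : Type*} [Fintype ι] {α : ι → Type*} [∀ i, MeasurableSpace (α i)]
    {μ ν : ∀ i, Measure (α i)} [∀ i, SigmaFinite (μ i)] (h : ∀ i, μ i ≤ ν i) :
    Measure.pi μ ≤ Measure.pi ν := by
  refine Measure.le_iff.2 fun s hs => ?_
  have h1 : (Measure.pi μ).toOuterMeasure ≤ OuterMeasure.pi fun i => (ν i).toOuterMeasure := by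
    refine OuterMeasure.le_pi.2 fun t _ => ?_
    change Measure.pi μ (Set.pi Set.univ t) ≤ _
    rw [Measure.pi_pi]
    exact Finset.prod_le_prod' fun i _ => h i (t i)
  rw [Measure.pi_def ν, toMeasure_apply _ _ hs]
  exact h1 s

lemma pi_le_smul_volume {ν : Measure ℂ} [SigmaFinite ν] {M : ℝ≥0} (h : ν ≤ (M : ℝ≥0∞) • volume)
    (n : ℕ) : Measure.pi (fun _ : Fin n => ν) ≤ (M : ℝ≥0∞) ^ n • volume := by
  have h' : ν ≤ M • volume := h
  refine (pi_mono_measure (ν := fun _ => M • volume) fun _ => h').trans (le_of_eq ?_)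
  refine Measure.pi_eq fun s _ => ?_
  have h2 : ∀ i, (M • (volume : Measure ℂ)) (s i) = M * volume (s i) := fun i => rfl
  rw [Measure.smul_apply, volume_pi_pi, smul_eq_mul]
  simp_rw [h2]
  rw [Finset.prod_mul_distrib, Finset.prod_const, Finset.card_univ, Fintype.card_fin]

lemma lintegral_prod_pow {f : ℂ → ℝ≥0∞} (hf : Measurable f) (n : ℕ) :
    ∫⁻ z : Fin n → ℂ, ∏ i, f (z i) = (∫⁻ x, f x) ^ n := by
  induction n with
  | zero => simp [volume_pi]
  | succ n ih =>
    have h := (volume_preserving_piFinSuccAbove (fun _ : Fin (n + 1) => ℂ) 0).symm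
    rw [← h.lintegral_comp_emb (MeasurableEquiv.measurableEmbedding _)]
    simp_rw [Fin.prod_univ_succ]
    have h2 := lintegral_prod_mul (μ := (volume : Measure ℂ)) (ν := (volume : Measure (Fin n → ℂ)))
      (f := f) (g := fun z => ∏ i, f (z i)) hf.aemeasurable
      (Finset.measurable_prod _ fun i _ => hf.comp (measurable_pi_apply i)).aemeasurable
    rw [ih, ← pow_succ'] at h2
    rw [← h2]
    rfl

/-- The function `t ↦ e^{-t}` on `[0, ∞]`. -/
noncomputable def expNeg (t : ℝ≥0∞) : ℝ≥0∞ := EReal.exp (-(t : EReal))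

lemma expNeg_antitone : Antitone expNeg := fun _ _ h =>
  EReal.exp_monotone (EReal.neg_le_neg_iff.2 (by exact_mod_cast h))

lemma expNeg_add (a b : ℝ≥0∞) : expNeg (a + b) = expNeg a * expNeg b := by
  rw [expNeg, expNeg, expNeg, ← EReal.exp_add, EReal.coe_ennreal_add, EReal.neg_add, sub_eq_add_neg]
  · left; exact EReal.coe_ennreal_ne_bot a
  · right; exact EReal.coe_ennreal_ne_bot b

lemma expNeg_zero : expNeg 0 = 1 := by simp [expNeg]

lemma expNeg_top : expNeg ⊤ = 0 := by simp [expNeg]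

lemma expNeg_coe (r : ℝ≥0) : expNeg r = ENNReal.ofReal (Real.exp (-r)) := by
  rw [expNeg, ← EReal.exp_coe]; rfl

lemma expNeg_sum {ι : Type*} (s : Finset ι) (f : ι → ℝ≥0∞) :
    expNeg (∑ i ∈ s, f i) = ∏ i ∈ s, expNeg (f i) := by
  classical
  induction s using Finset.induction_on with
  | empty => simp [expNeg_zero]
  | insert a s ha ih => rw [Finset.sum_insert ha, Finset.prod_insert ha, expNeg_add, ih]

lemma measurable_expNeg : Measurable expNeg := expNeg_antitone.measurable

lemma expNeg_ne_top (t : ℝ≥0∞) : expNeg t ≠ ⊤ :=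
  ne_top_of_le_ne_top (by simp) ((expNeg_antitone bot_le).trans expNeg_zero.le)

lemma expNeg_ne_zero {t : ℝ≥0∞} (ht : t ≠ ⊤) : expNeg t ≠ 0 := by
  lift t to ℝ≥0 using ht
  rw [expNeg_coe]
  simpa using Real.exp_pos _

/-- Jensen's inequality for `expNeg`. -/
lemma expNeg_lintegral_le {α : Type*} [MeasurableSpace α] {ρ : Measure α} [IsProbabilityMeasure ρ]
    {f : α → ℝ≥0∞} (hf : Measurable f) : expNeg (∫⁻ x, f x ∂ρ) ≤ ∫⁻ x, expNeg (f x) ∂ρ := by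
  rcases eq_or_ne (∫⁻ x, f x ∂ρ) ⊤ with h | h
  · rw [h, expNeg_top]; exact bot_le
  set q := ∫⁻ x, f x ∂ρ with hq
  -- the graph of `expNeg` lies above its tangent at `q`; this form avoids subtraction
  have htan : ∀ t : ℝ≥0∞, expNeg q * (1 + q) ≤ expNeg t + expNeg q * t := by
    intro t
    rcases eq_or_ne t ⊤ with rfl | ht
    · rw [ENNReal.mul_top (expNeg_ne_zero h)]; simp
    clear_value q
    lift q to ℝ≥0 using h
    lift t to ℝ≥0 using ht
    rw [expNeg_coe, expNeg_coe, ← ENNReal.ofReal_coe_nnreal (p := q),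
      ← ENNReal.ofReal_coe_nnreal (p := t), ← ENNReal.ofReal_one,
      ← ENNReal.ofReal_add (by norm_num) q.coe_nonneg, ← ENNReal.ofReal_mul (Real.exp_pos _).le,
      ← ENNReal.ofReal_mul (Real.exp_pos _).le, ← ENNReal.ofReal_add (Real.exp_pos _).le
        (mul_nonneg (Real.exp_pos _).le t.coe_nonneg)]
    refine ENNReal.ofReal_le_ofReal ?_
    have h1 := Real.add_one_le_exp ((q : ℝ) - t)
    have h2 : Real.exp (-(t : ℝ)) = Real.exp (-(q : ℝ)) * Real.exp ((q : ℝ) - t) := by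
      rw [← Real.exp_add]; congr 1; ring
    rw [h2]
    nlinarith [Real.exp_pos (-(q : ℝ))]
  have h1 : expNeg q + expNeg q * q ≤ ∫⁻ x, expNeg (f x) ∂ρ + expNeg q * q := by
    calc expNeg q + expNeg q * q = ∫⁻ _, expNeg q * (1 + q) ∂ρ := by simp; ring
      _ ≤ ∫⁻ x, (expNeg (f x) + expNeg q * f x) ∂ρ := lintegral_mono fun x => htan (f x)
      _ = _ := by
          have hm : Measurable fun x => expNeg (f x) := measurable_expNeg.comp hf
          rw [lintegral_add_left hm, lintegral_const_mul _ hf]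
  exact (ENNReal.add_le_add_iff_right (ENNReal.mul_ne_top (expNeg_ne_top q) h)).1 h1

/-! ### The energy of a configuration -/

/-- The total energy of the `2n` points `z_i, conj z_i` for the kernel `fieldKernel W`, where the
missing diagonal terms are replaced by the interaction of a point with its conjugate. -/
noncomputable def gasEnergy (W : ℂ → ℝ≥0∞) {n : ℕ} (z : Fin n → ℂ) : ℝ≥0∞ :=
  ∑ p ∈ (Finset.univ : Finset (Fin (n + n))).offDiag,
    fieldKernel W (doubled z p.1) (doubled z p.2)
  + ∑ i, fieldKernel W (doubled z i) (conj (doubled z i))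

lemma kernel_eq {V : ℂ → ℝ≥0∞} {C : ℝ≥0} (hC : ∀ z, ENNReal.ofReal (logGrowth z) ≤ V z + C)
    (x y : ℂ) :
    kernel V x y = (fieldKernel (sphField V C) x y : EReal) + ((-(C : ℝ) : ℝ) : EReal) := by
  rw [coe_fieldKernel hC, add_assoc, ← EReal.coe_add]
  simp

lemma coe_ennreal_sum {ι : Type*} (s : Finset ι) (f : ι → ℝ≥0∞) :
    ((∑ i ∈ s, f i : ℝ≥0∞) : EReal) = ∑ i ∈ s, (f i : EReal) := by
  classical
  induction s using Finset.induction_on with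
  | empty => simp
  | insert a s ha ih => rw [Finset.sum_insert ha, Finset.sum_insert ha, EReal.coe_ennreal_add, ih]

/-- By the symmetry of `V`, the terms `V z_i + log |z_i - conj z_i|⁻¹` of the exponent equal
`k(z_i, conj z_i)`. So the exponent is a sum of `(2n)²` values of `k`, and replacing each by the
spherical kernel changes it by a constant. -/
lemma exponent_eq {V : ℂ → ℝ≥0∞} {C : ℝ≥0} (hC : ∀ z, ENNReal.ofReal (logGrowth z) ≤ V z + C)
    (hconj : ∀ z, V (conj z) = V z) {n : ℕ} (z : Fin n → ℂ) :
    pairEnergy V z + ∑ i, ((V (doubled z i) : ℝ≥0∞) : EReal)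
      + ∑ i, logInv (doubled z i) (conj (doubled z i)) =
    (gasEnergy (sphField V C) z : EReal) + ((-((n + n : ℕ) ^ 2 * (C : ℝ)) : ℝ) : EReal) := by
  have hsum : ∀ {ι : Type} (s : Finset ι), ∑ _i ∈ s, ((-(C : ℝ) : ℝ) : EReal) =
      ((-(s.card * (C : ℝ)) : ℝ) : EReal) := by
    intro ι s
    rw [Finset.sum_const, ← EReal.coe_nsmul]
    congr 1
    rw [nsmul_eq_mul]; ring
  have h1 : ∑ i, ((V (doubled z i) : ℝ≥0∞) : EReal) + ∑ i, logInv (doubled z i) (conj (doubled z i))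
      = ∑ i, kernel V (doubled z i) (conj (doubled z i)) := by
    rw [← Finset.sum_add_distrib]
    refine Finset.sum_congr rfl fun i _ => ?_
    rw [kernel, hconj, ← two_mul, mul_comm (2 : ℝ≥0∞),
      ENNReal.mul_div_cancel_right (by simp) (by simp), add_comm]
  rw [add_assoc, h1, pairEnergy]
  simp_rw [kernel_eq hC]
  rw [Finset.sum_add_distrib, Finset.sum_add_distrib, hsum, hsum, ← coe_ennreal_sum,
    ← coe_ennreal_sum, add_add_add_comm, ← EReal.coe_ennreal_add, ← EReal.coe_add, gasEnergy]
  congr 2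
  rw [Finset.offDiag_card, Finset.card_univ, Fintype.card_fin, Nat.cast_sub (Nat.le_mul_self _)]
  push_cast; ring

/-- Up to a constant factor, the weight is the Boltzmann factor of `gasEnergy`. -/
lemma weight_eq {V : ℂ → ℝ≥0∞} {C : ℝ≥0} (hC : ∀ z, ENNReal.ofReal (logGrowth z) ≤ V z + C)
    (hconj : ∀ z, V (conj z) = V z) {n : ℕ} (z : Fin n → ℂ) :
    weight V z = ENNReal.ofReal (Real.exp ((n + n : ℕ) ^ 2 * (C : ℝ) / 2)) *
      expNeg (gasEnergy (sphField V C) z / 2) := by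
  rw [weight, exponent_eq hC hconj]
  generalize gasEnergy (sphField V C) z = Q
  rcases eq_or_ne Q ⊤ with rfl | hQ
  · rw [EReal.coe_ennreal_top, EReal.top_add_coe, EReal.coe_mul_top_of_neg (by norm_num),
      EReal.exp_bot, ENNReal.top_div_of_ne_top (by simp), expNeg_top, mul_zero]
  · lift Q to ℝ≥0 using hQ
    have h2 : ((Q : ℝ≥0∞) / 2) = ((Q / 2 : ℝ≥0) : ℝ≥0∞) := by
      rw [ENNReal.coe_div (by norm_num)]; rfl
    have h3 : (((Q : ℝ≥0) : ℝ≥0∞) : EReal) = ((Q : ℝ) : EReal) := rfl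
    rw [h2, expNeg_coe, ← ENNReal.ofReal_mul (Real.exp_pos _).le, ← Real.exp_add, h3,
      ← EReal.coe_add, ← EReal.coe_mul, EReal.exp_coe]
    congr 2
    push_cast; ring

lemma measurable_fieldKernel {W : ℂ → ℝ≥0∞} (hW : Measurable W) :
    Measurable fun p : ℂ × ℂ => fieldKernel W p.1 p.2 := by
  have := measurable_sphLog
  unfold fieldKernel
  fun_prop

lemma measurable_fieldKernel_comp {α : Type*} [MeasurableSpace α] {W : ℂ → ℝ≥0∞}
    (hW : Measurable W) {f g : α → ℂ} (hf : Measurable f) (hg : Measurable g) :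
    Measurable fun x => fieldKernel W (f x) (g x) := by
  have h := (measurable_fieldKernel hW).comp (hf.prodMk hg)
  exact h

lemma measurable_doubled (n : ℕ) (i : Fin (n + n)) :
    Measurable fun z : Fin n → ℂ => doubled z i := by
  unfold doubled
  refine Fin.addCases (fun a => ?_) (fun a => ?_) i
  · simp only [Fin.append_left]; fun_prop
  · simp only [Fin.append_right]; fun_prop

lemma measurable_gasEnergy {W : ℂ → ℝ≥0∞} (hW : Measurable W) (n : ℕ) :
    Measurable fun z : Fin n → ℂ => gasEnergy W z := by
  unfold gasEnergy
  refine Measurable.add ?_ ?_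
  · refine Finset.measurable_sum _ fun p _ => ?_
    exact measurable_fieldKernel_comp hW (measurable_doubled n p.1) (measurable_doubled n p.2)
  · refine Finset.measurable_sum _ fun i _ => ?_
    have h2 : Measurable fun z : Fin n → ℂ => conj (doubled z i) :=
      (by fun_prop : Measurable fun w : ℂ => conj w).comp (measurable_doubled n i)
    exact measurable_fieldKernel_comp hW (measurable_doubled n i) h2

lemma fieldKernel_conj {W : ℂ → ℝ≥0∞} (hconj : ∀ z, W (conj z) = W z) (x y : ℂ) :
    fieldKernel W (conj x) (conj y) = fieldKernel W x y := by
  rw [fieldKernel, fieldKernel, sphLog_conj, hconj, hconj]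

/-- The contribution of the pair `(a, b)` to `gasEnergy`. -/
noncomputable def pairTerm (W : ℂ → ℝ≥0∞) {n : ℕ} (z : Fin n → ℂ) (a b : Fin n) : ℝ≥0∞ :=
  (if a = b then fieldKernel W (z a) (conj (z a)) else fieldKernel W (z a) (z b))
    + fieldKernel W (z a) (conj (z b))

/-- Conjugating both points of a pair does not change its energy, so the pairs of the `2n` points
may be grouped by the indices of the `n` original ones. -/
lemma gasEnergy_eq {W : ℂ → ℝ≥0∞} (hconj : ∀ z, W (conj z) = W z) {n : ℕ} (z : Fin n → ℂ) :
    gasEnergy W z = 2 * ∑ a, ∑ b, pairTerm W z a b := by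
  have h0 : (Finset.univ : Finset (Fin (n + n))).offDiag =
      Finset.univ.filter fun p : Fin (n + n) × Fin (n + n) => p.1 ≠ p.2 := by ext; simp
  have hc : ∀ x y : ℂ, fieldKernel W (conj x) y = fieldKernel W x (conj y) := fun x y => by
    rw [← fieldKernel_conj hconj, Complex.conj_conj]
  have hcc : ∀ a b : Fin n, Fin.castAdd n a ≠ Fin.natAdd n b := fun a b h => by
    have := congrArg Fin.val h
    simp at this
    omega
  have h1 : ∑ p ∈ (Finset.univ : Finset (Fin (n + n))).offDiag,
      fieldKernel W (doubled z p.1) (doubled z p.2) =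
      2 * (∑ a, ∑ b, ((if a = b then 0 else fieldKernel W (z a) (z b)) +
        fieldKernel W (z a) (conj (z b)))) := by
    rw [h0, Finset.sum_filter, ← Finset.univ_product_univ, Finset.sum_product]
    simp only [Fin.sum_univ_add, doubled, Fin.append_left, Fin.append_right, hcc, (hcc _ _).symm,
      ne_eq, if_false, Fin.castAdd_inj, Fin.natAdd_inj, ite_not, hc,
      Complex.conj_conj, Finset.sum_add_distrib]
    ring
  have h2 : ∑ i, fieldKernel W (doubled z i) (conj (doubled z i)) =
      2 * ∑ a, ∑ b, (if a = b then fieldKernel W (z a) (conj (z a)) else 0) := by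
    simp only [Fin.sum_univ_add, doubled, Fin.append_left, Fin.append_right, hc,
      Complex.conj_conj, Finset.sum_ite_eq, Finset.mem_univ, if_true]
    ring
  rw [gasEnergy, h1, h2, ← mul_add, ← Finset.sum_add_distrib]
  congr 1
  refine Finset.sum_congr rfl fun a _ => ?_
  rw [← Finset.sum_add_distrib]
  refine Finset.sum_congr rfl fun b _ => ?_
  rw [pairTerm]
  split_ifs <;> ring

lemma fieldKernel_ge (W : ℂ → ℝ≥0∞) (x y : ℂ) : (W x + W y) / 2 ≤ fieldKernel W x y := le_add_self

/-- Each of the `2n` points takes part in `2n` interactions, so the energy confines the points. -/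
lemma four_mul_sum_le_gasEnergy {W : ℂ → ℝ≥0∞} (hconj : ∀ z, W (conj z) = W z) {n : ℕ}
    (z : Fin n → ℂ) : 4 * n * ∑ a, W (z a) ≤ gasEnergy W z := by
  have h1 : ∀ a b, W (z a) + W (z b) ≤ pairTerm W z a b := by
    intro a b
    have h2 : (W (z a) + W (z b)) / 2 ≤
        if a = b then fieldKernel W (z a) (conj (z a)) else fieldKernel W (z a) (z b) := by
      split_ifs with h
      · subst h
        exact (by simp [hconj] : (W (z a) + W (z a)) / 2 = (W (z a) + W (conj (z a))) / 2).le.trans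
          (fieldKernel_ge W _ _)
      · exact fieldKernel_ge W _ _
    have h3 : (W (z a) + W (z b)) / 2 ≤ fieldKernel W (z a) (conj (z b)) := by
      have := fieldKernel_ge W (z a) (conj (z b))
      rwa [hconj] at this
    calc W (z a) + W (z b) = (W (z a) + W (z b)) / 2 + (W (z a) + W (z b)) / 2 :=
          (ENNReal.add_halves _).symm
      _ ≤ _ := add_le_add h2 h3
  rw [gasEnergy_eq hconj]
  calc 4 * n * ∑ a, W (z a) = 2 * ∑ a, ∑ b, (W (z a) + W (z b)) := by
        simp only [Finset.sum_add_distrib, Finset.sum_const, Finset.card_univ, Fintype.card_fin,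
          nsmul_eq_mul, ← Finset.mul_sum]
        ring
    _ ≤ _ := by gcongr with a _ b _; exact h1 a b

/-! ### Lower bound for the partition function -/

lemma measurable_conj : Measurable fun z : ℂ => conj z := by fun_prop

/-- By positive definiteness, the interaction of a measure with its complex conjugate is at most its
energy. -/
lemma lintegral_fieldKernel_conj_le {W : ℂ → ℝ≥0∞} (hW : Measurable W) (hgr : HasLogGrowth W)
    (hconj : ∀ z, W (conj z) = W z) (ν : Measure ℂ) [IsProbabilityMeasure ν] :
    ∫⁻ p, fieldKernel W p.1 (conj p.2) ∂(ν.prod ν) ≤ fieldEnergy W ν := by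
  rcases eq_or_ne (∫⁻ z, W z ∂ν) ⊤ with hfin | hfin
  · rw [fieldEnergy_eq hW, hfin]; simp
  have hm := measurable_sphLog
  set ν' : Measure ℂ := ν.map fun z => conj z with hν'
  have : IsProbabilityMeasure ν' :=
    Measure.isProbabilityMeasure_map measurable_conj.aemeasurable
  have hW' : ∫⁻ z, W z ∂ν' = ∫⁻ z, W z ∂ν := by
    rw [hν', lintegral_map hW measurable_conj]
    simp_rw [hconj]
  have hS' : sphEnergy ν' ν' = sphEnergy ν ν := by
    rw [sphEnergy, hν', Measure.map_prod_map _ _ measurable_conj measurable_conj,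
      lintegral_map hm (by fun_prop)]
    exact lintegral_congr fun p => sphLog_conj p.1 p.2
  have hlog := hgr.logMoment_ne_top hfin
  have hlog' := hgr.logMoment_ne_top (μ := ν') (by rwa [hW'])
  have h1 := two_mul_sphEnergy_le ν ν' hlog hlog'
  rw [hS', ← two_mul, ENNReal.mul_le_mul_iff_right (by simp) (by simp)] at h1
  have h2 : ∫⁻ p, fieldKernel W p.1 (conj p.2) ∂(ν.prod ν) =
      ∫⁻ p, fieldKernel W p.1 p.2 ∂(ν.prod ν') := by
    have h3 : ν.prod ν' = (ν.prod ν).map (Prod.map id fun z => conj z) := by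
      rw [hν', ← Measure.map_prod_map _ _ measurable_id measurable_conj, Measure.map_id]
    rw [h3, lintegral_map (measurable_fieldKernel hW) (by fun_prop)]
    rfl
  rw [h2, lintegral_fieldKernel hW, hW', ← two_mul, mul_comm (2 : ℝ≥0∞),
    ENNReal.mul_div_cancel_right (by simp) (by simp), fieldEnergy_eq hW]
  gcongr

lemma lintegral_pi_pair {ν : Measure ℂ} [IsProbabilityMeasure ν] {n : ℕ} {a b : Fin n} (h : a ≠ b)
    {g : ℂ × ℂ → ℝ≥0∞} (hg : Measurable g) :
    ∫⁻ z, g (z a, z b) ∂(Measure.pi fun _ : Fin n => ν) = ∫⁻ p, g p ∂(ν.prod ν) := by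
  have h1 : iIndepFun (fun (i : Fin n) (z : Fin n → ℂ) => z i) (Measure.pi fun _ : Fin n => ν) :=
    iIndepFun_pi (X := fun _ : Fin n => (id : ℂ → ℂ)) fun _ => aemeasurable_id
  have h2 := (indepFun_iff_map_prod_eq_prod_map_map
    (measurable_pi_apply a).aemeasurable (measurable_pi_apply b).aemeasurable).1 (h1.indepFun h)
  rw [(measurePreserving_eval (fun _ : Fin n => ν) a).map_eq,
    (measurePreserving_eval (fun _ : Fin n => ν) b).map_eq] at h2
  rw [← h2, lintegral_map hg (by fun_prop)]

lemma lintegral_pi_single {ν : Measure ℂ} [IsProbabilityMeasure ν] {n : ℕ} (a : Fin n)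
    {g : ℂ → ℝ≥0∞} (hg : Measurable g) :
    ∫⁻ z, g (z a) ∂(Measure.pi fun _ : Fin n => ν) = ∫⁻ x, g x ∂ν :=
  (measurePreserving_eval (fun _ : Fin n => ν) a).lintegral_comp hg

lemma lintegral_pairTerm_le {W : ℂ → ℝ≥0∞} (hW : Measurable W) (hgr : HasLogGrowth W)
    (hconj : ∀ z, W (conj z) = W z) (ν : Measure ℂ) [IsProbabilityMeasure ν] {n : ℕ}
    (a b : Fin n) :
    ∫⁻ z, pairTerm W z a b ∂(Measure.pi fun _ : Fin n => ν) ≤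
      2 * fieldEnergy W ν + if a = b then 2 * ∫⁻ z, fieldKernel W z (conj z) ∂ν else 0 := by
  have hm := measurable_fieldKernel hW
  have hmc : Measurable fun p : ℂ × ℂ => fieldKernel W p.1 (conj p.2) :=
    measurable_fieldKernel_comp hW measurable_fst (measurable_conj.comp measurable_snd)
  have hmd : Measurable fun z : ℂ => fieldKernel W z (conj z) :=
    measurable_fieldKernel_comp hW measurable_id measurable_conj
  by_cases h : a = b
  · subst h
    simp only [pairTerm, if_true]
    have h1 := lintegral_pi_single (ν := ν) a (hmd.add hmd)
    simp only [Pi.add_apply] at h1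
    rw [h1, lintegral_add_left hmd, ← two_mul]
    exact le_add_self
  · simp only [pairTerm, h, if_false, add_zero]
    have hm2 : Measurable fun z : Fin n → ℂ => fieldKernel W (z a) (z b) :=
      measurable_fieldKernel_comp hW (measurable_pi_apply a) (measurable_pi_apply b)
    rw [lintegral_add_left hm2, two_mul]
    have h1 := lintegral_pi_pair (ν := ν) h hm
    have h2 := lintegral_pi_pair (ν := ν) h hmc
    simp only at h1 h2
    rw [h1, h2]
    exact add_le_add le_rfl (lintegral_fieldKernel_conj_le hW hgr hconj ν)

/-- The mean energy of a gas of independent points with distribution `ν`. -/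
lemma lintegral_gasEnergy_le {W : ℂ → ℝ≥0∞} (hW : Measurable W) (hgr : HasLogGrowth W)
    (hconj : ∀ z, W (conj z) = W z) (ν : Measure ℂ) [IsProbabilityMeasure ν] (n : ℕ) :
    ∫⁻ z, gasEnergy W z ∂(Measure.pi fun _ : Fin n => ν) ≤
      4 * n ^ 2 * fieldEnergy W ν + 4 * n * ∫⁻ z, fieldKernel W z (conj z) ∂ν := by
  have hm : ∀ a b : Fin n, Measurable fun z : Fin n → ℂ => pairTerm W z a b := by
    intro a b
    have h1 : Measurable fun z : Fin n → ℂ => fieldKernel W (z a) (conj (z a)) :=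
      measurable_fieldKernel_comp hW (measurable_pi_apply a)
        (measurable_conj.comp (measurable_pi_apply a))
    have h2 : Measurable fun z : Fin n → ℂ => fieldKernel W (z a) (conj (z b)) :=
      measurable_fieldKernel_comp hW (measurable_pi_apply a)
        (measurable_conj.comp (measurable_pi_apply b))
    have h3 : Measurable fun z : Fin n → ℂ => fieldKernel W (z a) (z b) :=
      measurable_fieldKernel_comp hW (measurable_pi_apply a) (measurable_pi_apply b)
    unfold pairTerm
    split_ifs
    · exact h1.add h2
    · exact h3.add h2
  simp_rw [gasEnergy_eq hconj]
  rw [lintegral_const_mul _ (Finset.measurable_sum _ fun a _ => Finset.measurable_sum _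
    fun b _ => hm a b), lintegral_finsetSum _ fun a _ => Finset.measurable_sum _ fun b _ => hm a b]
  simp_rw [lintegral_finsetSum _ fun b _ => hm _ b]
  calc _ ≤ 2 * ∑ a : Fin n, ∑ b : Fin n, (2 * fieldEnergy W ν +
        if a = b then 2 * ∫⁻ z, fieldKernel W z (conj z) ∂ν else 0) := by
        gcongr with a _ b _
        exact lintegral_pairTerm_le hW hgr hconj ν a b
    _ = _ := by
        simp only [Finset.sum_add_distrib, Finset.sum_ite_eq, Finset.mem_univ, if_true,
          Finset.sum_const, Finset.card_univ, Fintype.card_fin, nsmul_eq_mul]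
        ring

/-- The partition function of the gas with energy `gasEnergy W`. -/
noncomputable def gasPartition (W : ℂ → ℝ≥0∞) (n : ℕ) : ℝ≥0∞ :=
  ∫⁻ z : Fin n → ℂ, expNeg (gasEnergy W z / 2)

lemma measurable_expNeg_gasEnergy {W : ℂ → ℝ≥0∞} (hW : Measurable W) (n : ℕ) :
    Measurable fun z : Fin n → ℂ => expNeg (gasEnergy W z / 2) :=
  measurable_expNeg.comp ((measurable_gasEnergy hW n).div_const 2)

/-- Lower bound for the partition function, by Jensen's inequality for independent points. -/
lemma expNeg_le_gasPartition {W : ℂ → ℝ≥0∞} (hW : Measurable W) (hgr : HasLogGrowth W)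
    (hconj : ∀ z, W (conj z) = W z) (ν : Measure ℂ) [IsProbabilityMeasure ν] {M : ℝ≥0}
    (hM : ν ≤ (M : ℝ≥0∞) • volume) (n : ℕ) :
    expNeg (2 * n ^ 2 * fieldEnergy W ν + 2 * n * ∫⁻ z, fieldKernel W z (conj z) ∂ν) ≤
      (M : ℝ≥0∞) ^ n * gasPartition W n := by
  have hhalf : (4 : ℝ≥0∞) * 2⁻¹ = 2 := by
    rw [show (4 : ℝ≥0∞) = 2 * 2 by norm_num, mul_assoc, ENNReal.mul_inv_cancel (by simp) (by simp),
      mul_one]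
  calc _ ≤ expNeg (∫⁻ z, gasEnergy W z / 2 ∂(Measure.pi fun _ : Fin n => ν)) := by
        refine expNeg_antitone ?_
        simp_rw [div_eq_mul_inv]
        rw [lintegral_mul_const _ (measurable_gasEnergy hW n)]
        calc _ ≤ (4 * n ^ 2 * fieldEnergy W ν +
                4 * n * ∫⁻ z, fieldKernel W z (conj z) ∂ν) * 2⁻¹ := by
              gcongr; exact lintegral_gasEnergy_le hW hgr hconj ν n
          _ = (4 * 2⁻¹) * n ^ 2 * fieldEnergy W ν
              + (4 * 2⁻¹) * n * ∫⁻ z, fieldKernel W z (conj z) ∂ν := by ring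
          _ = _ := by rw [hhalf]
    _ ≤ ∫⁻ z, expNeg (gasEnergy W z / 2) ∂(Measure.pi fun _ : Fin n => ν) :=
        expNeg_lintegral_le ((measurable_gasEnergy hW n).div_const 2)
    _ ≤ ∫⁻ z, expNeg (gasEnergy W z / 2) ∂((M : ℝ≥0∞) ^ n • volume) :=
        lintegral_mono' (pi_le_smul_volume hM n) le_rfl
    _ = _ := by rw [lintegral_smul_measure, smul_eq_mul, gasPartition]

/-- A high enough power of the Boltzmann factor of the field is integrable over the plane. -/
lemma exists_lintegral_expNeg_ne_top {W : ℂ → ℝ≥0∞} (hgr : HasLogGrowth W) :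
    ∃ T : ℝ≥0, ∫⁻ z, expNeg (T * W z) ≠ ⊤ := by
  obtain ⟨c, A, hc, hcA⟩ := hgr
  have hc' : (c : ℝ≥0∞) ≠ 0 := by simpa using hc
  -- with this choice the integrand is at most a multiple of `(1 + |z|²)⁻²`
  refine ⟨2 / c, ?_⟩
  set T : ℝ≥0 := 2 / c with hT
  have hTA : expNeg (T * A) ≠ 0 := expNeg_ne_zero (by finiteness)
  have hTc : (T : ℝ≥0∞) * c = 2 := by
    rw [← ENNReal.coe_mul, hT, div_mul_cancel₀ _ hc]; rfl
  have h1 : ∀ z, expNeg (T * W z) * expNeg (T * A) ≤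
      ENNReal.ofReal ((1 + ‖z‖ ^ 2) ^ (-4 / 2 : ℝ)) := by
    intro z
    rw [← expNeg_add, ← mul_add]
    refine (expNeg_antitone (mul_le_mul_right (hcA z) _)).trans (le_of_eq ?_)
    rw [← mul_assoc, hTc, ENNReal.ofReal, ← ENNReal.coe_ofNat, ← ENNReal.coe_mul, expNeg_coe]
    congr 1
    rw [NNReal.coe_mul, Real.coe_toNNReal _ (logGrowth_nonneg z), logGrowth,
      Real.rpow_def_of_pos (by positivity)]
    congr 1
    norm_num; ring
  have h2 : Integrable fun z : ℂ => (1 + ‖z‖ ^ 2) ^ (-4 / 2 : ℝ) :=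
    integrable_rpow_neg_one_add_norm_sq (by simp; norm_num)
  have h3 : (∫⁻ z, expNeg (T * W z)) * expNeg (T * A) ≠ ⊤ := by
    rw [← lintegral_mul_const' _ _ (expNeg_ne_top _)]
    exact ne_top_of_le_ne_top h2.lintegral_lt_top.ne (lintegral_mono h1)
  intro h4
  rw [h4, ENNReal.top_mul hTA] at h3
  exact h3 rfl

/-- Upper bound for the unnormalized mass of the configurations of energy at least `τ`: a part `s`
of the Boltzmann factor is bounded by its value at `τ`, the remaining part `t` makes the integral
converge. -/
lemma setLIntegral_expNeg_gasEnergy_le {W : ℂ → ℝ≥0∞} (hW : Measurable W)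
    (hconj : ∀ z, W (conj z) = W z) {s t : ℝ≥0} (hst : s + t = 1) {T : ℝ≥0} {n : ℕ}
    (hT : T ≤ 2 * n * t) (τ : ℝ≥0∞) :
    ∫⁻ z in {z : Fin n → ℂ | τ ≤ gasEnergy W z}, expNeg (gasEnergy W z / 2) ≤
      expNeg (s * τ / 2) * (∫⁻ x, expNeg (T * W x)) ^ n := by
  have hmB : MeasurableSet {z : Fin n → ℂ | τ ≤ gasEnergy W z} :=
    measurableSet_le measurable_const (measurable_gasEnergy hW n)
  have hmT : Measurable fun x => expNeg (T * W x) := measurable_expNeg.comp (hW.const_mul _)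
  rw [← lintegral_prod_pow hmT, ← lintegral_const_mul' _ _ (expNeg_ne_top _)]
  refine le_trans (setLIntegral_mono' hmB fun z hz => ?_) (setLIntegral_le_lintegral _ _)
  have hz' : τ ≤ gasEnergy W z := hz
  rw [← expNeg_sum, ← expNeg_add]
  refine expNeg_antitone ?_
  have hst' : (s : ℝ≥0∞) + t = 1 := by exact_mod_cast congrArg ((↑) : ℝ≥0 → ℝ≥0∞) hst
  have h1 := four_mul_sum_le_gasEnergy hconj z
  have hhalf : (4 : ℝ≥0∞) * 2⁻¹ = 2 := by
    rw [show (4 : ℝ≥0∞) = 2 * 2 by norm_num, mul_assoc, ENNReal.mul_inv_cancel (by simp) (by simp),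
      mul_one]
  have hT' : (T : ℝ≥0∞) ≤ 2 * n * t := by exact_mod_cast hT
  calc s * τ / 2 + ∑ i, T * W (z i) ≤ s * gasEnergy W z / 2 + t * gasEnergy W z / 2 := by
        refine add_le_add (by gcongr) ?_
        rw [← Finset.mul_sum]
        calc T * ∑ i, W (z i) ≤ (2 * n * t) * ∑ i, W (z i) := by gcongr
          _ = ((4 * 2⁻¹) * n * t) * ∑ i, W (z i) := by rw [hhalf]
          _ = t * (4 * n * ∑ i, W (z i)) / 2 := by rw [div_eq_mul_inv]; ring
          _ ≤ t * gasEnergy W z / 2 := by gcongr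
    _ = gasEnergy W z / 2 := by rw [← ENNReal.add_div, ← add_mul, hst', one_mul]

/-! ### Configurations of large energy are rare -/

lemma expNeg_natCast_mul (n : ℕ) (a : ℝ≥0∞) : expNeg (n * a) = expNeg a ^ n := by
  have h := expNeg_sum (Finset.range n) fun _ => a
  simpa [Finset.prod_const] using h

lemma expNeg_lt_one {a : ℝ≥0} (ha : a ≠ 0) : expNeg a < 1 := by
  rw [expNeg_coe, ENNReal.ofReal_lt_one, Real.exp_lt_one_iff]
  have : (0 : ℝ) < a := by exact_mod_cast pos_iff_ne_zero.2 ha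
  linarith

/-- The probability that the energy per pair exceeds that of a given measure by at least `ε` is
eventually exponentially small. The errors in the estimates are factors that are only exponential
in `n`, so a gain of order `ε n²` in the exponent outweighs them. -/
theorem eventually_tail_le {W : ℂ → ℝ≥0∞} (hW : Continuous W) (hgr : HasLogGrowth W)
    (hconj : ∀ z, W (conj z) = W z) (μ : Measure ℂ) [IsProbabilityMeasure μ]
    (hfin : fieldEnergy W μ ≠ ⊤) {ε : ℝ≥0} (hε : ε ≠ 0) :
    ∀ᶠ n : ℕ in atTop, (gasPartition W n)⁻¹ *
      ∫⁻ z in {z : Fin n → ℂ | 4 * n ^ 2 * (fieldEnergy W μ + ε) ≤ gasEnergy W z},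
        expNeg (gasEnergy W z / 2) ≤ 2⁻¹ ^ n := by
  have hε0 : 0 < ε := pos_iff_ne_zero.2 hε
  obtain ⟨ν, M, hν, hνM, hνF, hνD⟩ := exists_bounded_density hW hgr hconj μ hfin
    (ε := ε / 4) (by positivity)
  obtain ⟨T, hZ⟩ := exists_lintegral_expNeg_ne_top hgr
  set Z := ∫⁻ x, expNeg (T * W x) with hZdef
  set D := ∫⁻ z, fieldKernel W z (conj z) ∂ν with hDdef
  generalize hmF : fieldEnergy W μ = m at *
  lift m to ℝ≥0 using hfin
  have hε4 : ENNReal.ofReal ((ε : ℝ) / 4) = ((ε / 4 : ℝ≥0) : ℝ≥0∞) := by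
    rw [ENNReal.ofReal, Real.toNNReal_div' (by norm_num)]; simp
  rw [hε4] at hνF
  -- the splitting of the Boltzmann factor, such that `s (m + ε) = m + ε / 2`
  set s : ℝ≥0 := (m + ε / 2) / (m + ε) with hs
  set t : ℝ≥0 := (ε / 2) / (m + ε) with ht
  have hmε : m + ε ≠ 0 := (add_pos_of_nonneg_of_pos zero_le hε0).ne'
  have hst : s + t = 1 := by
    rw [hs, ht, ← add_div, add_assoc, add_halves, div_self hmε]
  have hsm : s * (m + ε) = m + ε / 2 := div_mul_cancel₀ _ hmε
  have ht0 : 0 < t := by positivity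
  have e1 : ∀ᶠ n : ℕ in atTop, T ≤ 2 * n * t := by
    obtain ⟨N, hN⟩ := exists_nat_ge (T / (2 * t))
    filter_upwards [eventually_ge_atTop N] with n hn
    have h1 : T / (2 * t) ≤ (n : ℝ≥0) := hN.trans (by exact_mod_cast hn)
    rw [div_le_iff₀ (by positivity)] at h1
    calc T ≤ n * (2 * t) := h1
      _ = _ := by ring
  have e2 : ∀ᶠ n : ℕ in atTop, M * Z * expNeg (n * (ε / 2 : ℝ≥0)) ≤ expNeg (2 * D) * 2⁻¹ := by
    have h1 : Tendsto (fun n : ℕ => M * Z * expNeg ((ε / 2 : ℝ≥0)) ^ n) atTop (𝓝 (M * Z * 0)) :=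
      ENNReal.Tendsto.const_mul
        (ENNReal.tendsto_pow_atTop_nhds_zero_of_lt_one (expNeg_lt_one (by positivity)))
        (Or.inr (by finiteness))
    rw [mul_zero] at h1
    have h2 : (0 : ℝ≥0∞) < expNeg (2 * D) * 2⁻¹ :=
      ENNReal.mul_pos (expNeg_ne_zero (by finiteness)) (by simp)
    filter_upwards [h1.eventually_lt_const h2] with n hn
    rw [expNeg_natCast_mul]
    exact hn.le
  filter_upwards [e1, e2] with n hn1 hn2
  set I := ∫⁻ z in {z : Fin n → ℂ | 4 * n ^ 2 * ((m : ℝ≥0∞) + ε) ≤ gasEnergy W z},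
        expNeg (gasEnergy W z / 2) with hI
  have hhalf : (2 : ℝ≥0∞) * 2⁻¹ = 1 := ENNReal.mul_inv_cancel (by simp) (by simp)
  set a : ℝ≥0∞ := 2 * n ^ 2 * ((m : ℝ≥0∞) + (ε / 4 : ℝ≥0)) with ha
  -- upper bound `exp (-2 n² (m + ε / 2)) Z ^ n` for the unnormalized mass
  have hIle : I ≤ expNeg (a + n * (n * (ε / 2 : ℝ≥0))) * Z ^ n := by
    refine (setLIntegral_expNeg_gasEnergy_le hW.measurable hconj hst hn1 _).trans (le_of_eq ?_)
    congr 2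
    have h1 : (s : ℝ≥0∞) * (m + ε) = ((m + ε / 2 : ℝ≥0) : ℝ≥0∞) := by exact_mod_cast hsm
    have h2 : ((m + ε / 2 : ℝ≥0) : ℝ≥0∞) = m + (ε / 4 : ℝ≥0) + (ε / 4 : ℝ≥0) := by
      rw [← ENNReal.coe_add, ← ENNReal.coe_add]
      congr 1
      rw [add_assoc]
      congr 1
      field_simp; norm_num
    have h3 : ((ε / 2 : ℝ≥0) : ℝ≥0∞) = 2 * (ε / 4 : ℝ≥0) := by
      rw [← ENNReal.coe_ofNat, ← ENNReal.coe_mul]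
      congr 1
      field_simp; norm_num
    calc (s : ℝ≥0∞) * (4 * n ^ 2 * (m + ε)) / 2 = (2 * 2⁻¹) * (2 * n ^ 2 * (s * (m + ε))) := by
          rw [div_eq_mul_inv]; ring
      _ = _ := by rw [hhalf, h1, h2, h3, ha]; ring
  -- lower bound `M⁻ⁿ exp (-2 n² (m + ε / 4) - 2 n D)` for the partition function
  have hE : expNeg (a + n * (2 * D)) ≤ (M : ℝ≥0∞) ^ n * gasPartition W n := by
    refine le_trans (expNeg_antitone ?_) (expNeg_le_gasPartition hW.measurable hgr hconj ν hνM n)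
    calc 2 * (n : ℝ≥0∞) ^ 2 * fieldEnergy W ν + 2 * n * D ≤ a + 2 * n * D := by
          rw [ha]; gcongr
      _ = a + n * (2 * D) := by ring
  have hEfin : a + n * (2 * D) ≠ ⊤ := by
    rw [ha]
    finiteness
  -- the quotient is at most `(M Z exp (2 D - n ε / 2)) ^ n`, whose base tends to `0`
  rw [← ENNReal.mul_le_mul_iff_right (expNeg_ne_zero hEfin) (expNeg_ne_top _)]
  calc expNeg (a + n * (2 * D)) * ((gasPartition W n)⁻¹ * I)
      ≤ ((M : ℝ≥0∞) ^ n * gasPartition W n) * ((gasPartition W n)⁻¹ * I) := by gcongr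
    _ = (gasPartition W n * (gasPartition W n)⁻¹) * ((M : ℝ≥0∞) ^ n * I) := by ring
    _ ≤ 1 * ((M : ℝ≥0∞) ^ n * I) := by gcongr; exact ENNReal.mul_inv_le_one _
    _ ≤ 1 * ((M : ℝ≥0∞) ^ n * (expNeg (a + n * (n * (ε / 2 : ℝ≥0))) * Z ^ n)) := by gcongr
    _ = expNeg a * (M * Z * expNeg (n * (ε / 2 : ℝ≥0))) ^ n := by
        rw [expNeg_add, expNeg_natCast_mul n (n * _)]; ring
    _ ≤ expNeg a * (expNeg (2 * D) * 2⁻¹) ^ n := by gcongr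
    _ = _ := by rw [expNeg_add, expNeg_natCast_mul n (2 * D)]; ring

/-- The distribution of the gas in terms of `gasEnergy`; the constant factor of the weight
cancels. -/
lemma gasLaw_apply {V : ℂ → ℝ≥0∞} {C : ℝ≥0} (hC : ∀ z, ENNReal.ofReal (logGrowth z) ≤ V z + C)
    (hV : Continuous V) (hconj : ∀ z, V (conj z) = V z) (n : ℕ) {B : Set (Fin n → ℂ)}
    (hB : MeasurableSet B) :
    gasLaw V n B = (gasPartition (sphField V C) n)⁻¹ *
      ∫⁻ z in B, expNeg (gasEnergy (sphField V C) z / 2) := by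
  have hm := measurable_expNeg_gasEnergy (continuous_sphField hV C).measurable n
  set c := ENNReal.ofReal (Real.exp ((n + n : ℕ) ^ 2 * (C : ℝ) / 2)) with hc
  have hc0 : c ≠ 0 := by simpa [hc] using Real.exp_pos _
  have hctop : c ≠ ⊤ := ENNReal.ofReal_ne_top
  have hpart : partitionFunction V n = c * gasPartition (sphField V C) n := by
    rw [partitionFunction]
    simp_rw [weight_eq hC hconj]
    rw [lintegral_const_mul _ hm]
    rfl
  rw [gasLaw, withDensity_apply _ hB, ← lintegral_const_mul _ hm]
  refine lintegral_congr fun z => ?_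
  rw [weight_eq hC hconj, hpart, ← hc, ENNReal.mul_inv (Or.inl hc0) (Or.inl hctop)]
  calc _ = (c⁻¹ * c) * ((gasPartition (sphField V C) n)⁻¹ *
        expNeg (gasEnergy (sphField V C) z / 2)) := by ring
    _ = _ := by rw [ENNReal.inv_mul_cancel hc0 hctop, one_mul]

/-- Almost surely, the energy per pair is eventually below the energy of any given measure plus `ε`.
The Borel–Cantelli lemma needs no independence, so the joint distribution does not matter. -/
theorem ae_eventually_gasEnergy_lt {V : ℂ → ℝ≥0∞} {C : ℝ≥0}
    (hC : ∀ z, ENNReal.ofReal (logGrowth z) ≤ V z + C) (hV : Continuous V)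
    (hconj : ∀ z, V (conj z) = V z) (hgr : HasLogGrowth (sphField V C)) (μ : Measure ℂ)
    [IsProbabilityMeasure μ] (hfin : fieldEnergy (sphField V C) μ ≠ ⊤)
    {Ω : Type*} [MeasurableSpace Ω] (P : Measure Ω)
    (z : (n : ℕ) → Ω → Fin n → ℂ) (hz : ∀ n, 1 ≤ n → HasLaw (z n) (gasLaw V n) P)
    {ε : ℝ≥0} (hε : ε ≠ 0) :
    ∀ᵐ ω ∂P, ∀ᶠ n : ℕ in atTop, gasEnergy (sphField V C) (z n ω) <
      4 * n ^ 2 * (fieldEnergy (sphField V C) μ + ε) := by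
  set W := sphField V C
  have hW : Continuous W := continuous_sphField hV C
  have hWconj : ∀ z, W (conj z) = W z := sphField_conj hconj C
  obtain ⟨N, hN⟩ := eventually_atTop.1 (eventually_tail_le hW hgr hWconj μ hfin hε)
  let B : (n : ℕ) → Set (Fin n → ℂ) := fun n =>
    {z | 4 * n ^ 2 * (fieldEnergy W μ + ε) ≤ gasEnergy W z}
  have hB : ∀ n, MeasurableSet (B n) := fun n =>
    measurableSet_le measurable_const (measurable_gasEnergy hW.measurable n)
  have hP : ∀ n, 1 ≤ n → N ≤ n → P (z n ⁻¹' B n) ≤ 2⁻¹ ^ n := by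
    intro n h1 h2
    rw [← Measure.map_apply_of_aemeasurable (hz n h1).aemeasurable (hB n), (hz n h1).map_eq,
      gasLaw_apply hC hV hconj n (hB n)]
    exact hN n h2
  -- the shift of the index leaves out `n = 0` and all `n` for which the tail bound may fail
  have hsum : ∑' i, P (z (i + (N + 1)) ⁻¹' B (i + (N + 1))) ≠ ⊤ := by
    refine ne_top_of_le_ne_top (b := ∑' i : ℕ, (2⁻¹ : ℝ≥0∞) ^ i) ?_ ?_
    · rw [ENNReal.tsum_geometric, ENNReal.one_sub_inv_two, inv_inv]
      simp
    · refine ENNReal.tsum_le_tsum fun i => (hP _ (by omega) (by omega)).trans ?_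
      exact pow_le_pow_right_of_le_one' (ENNReal.inv_le_one.2 (by norm_num)) (by omega)
  filter_upwards [ae_eventually_notMem hsum] with ω hω
  obtain ⟨k, hk⟩ := eventually_atTop.1 hω
  filter_upwards [eventually_ge_atTop (k + (N + 1))] with n hn
  have h1 := hk (n - (N + 1)) (by omega)
  rw [Nat.sub_add_cancel (by omega)] at h1
  exact not_le.1 h1

/-! ### Convergence of empirical measures -/

lemma lintegral_empiricalMeasure {n : ℕ} (hn : n ≠ 0) (z : Fin n → ℂ) {f : ℂ → ℝ≥0∞}
    (hf : Measurable f) :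
    ∫⁻ x, f x ∂(empiricalMeasure z : Measure ℂ) =
      (2 * n : ℝ≥0∞)⁻¹ * ∑ i, f (doubled z i) := by
  have h0 : (2 * (n : ℝ≥0)) ≠ 0 := by positivity
  rw [empiricalMeasure, FiniteMeasure.toMeasure_smul, FiniteMeasure.toMeasure_sum]
  have h1 : ∀ i, ((diracProba (doubled z i)).toFiniteMeasure : Measure ℂ) =
      Measure.dirac (doubled z i) := fun _ => rfl
  simp_rw [h1]
  rw [lintegral_smul_measure, lintegral_finsetSum_measure]
  simp_rw [lintegral_dirac' _ hf]
  rw [ENNReal.smul_def, smul_eq_mul, ENNReal.coe_inv h0]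
  norm_cast

lemma isProbabilityMeasure_empiricalMeasure {n : ℕ} (hn : n ≠ 0) (z : Fin n → ℂ) :
    IsProbabilityMeasure (empiricalMeasure z : Measure ℂ) := by
  constructor
  have h := lintegral_empiricalMeasure hn z (f := fun _ => 1) measurable_const
  rw [lintegral_one] at h
  rw [h]
  simp only [Finset.sum_const, Finset.card_univ, Fintype.card_fin, nsmul_eq_mul, mul_one]
  rw [Nat.cast_add, ← two_mul]
  exact ENNReal.inv_mul_cancel (by simpa using hn) (by finiteness)

open Classical in
/-- The empirical measure as a probability measure; for `n = 0`, where the empirical measure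
vanishes, the value is irrelevant. -/
noncomputable def empiricalProba {n : ℕ} (z : Fin n → ℂ) : ProbabilityMeasure ℂ :=
  if hn : n ≠ 0 then
    (⟨(empiricalMeasure z : Measure ℂ), isProbabilityMeasure_empiricalMeasure hn z⟩ :
      ProbabilityMeasure ℂ)
  else diracProba 0

lemma coe_empiricalProba {n : ℕ} (hn : n ≠ 0) (z : Fin n → ℂ) :
    (empiricalProba z : Measure ℂ) = empiricalMeasure z := by
  exact congrArg Subtype.val (dif_pos hn)

lemma four_mul_sq_inv_mul {n : ℕ} (hn : n ≠ 0) (c : ℝ≥0∞) :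
    (2 * n : ℝ≥0∞)⁻¹ * ((2 * n : ℝ≥0∞)⁻¹ * (4 * n ^ 2 * c)) = c := by
  have h : (2 * n : ℝ≥0∞)⁻¹ * (2 * n : ℝ≥0∞) = 1 :=
    ENNReal.inv_mul_cancel (by simpa using hn) (by finiteness)
  calc _ = ((2 * n : ℝ≥0∞)⁻¹ * (2 * n : ℝ≥0∞)) * ((2 * n : ℝ≥0∞)⁻¹ * (2 * n : ℝ≥0∞)) * c := by ring
    _ = c := by rw [h]; simp

lemma lintegral_empiricalProba_le {W : ℂ → ℝ≥0∞} (hW : Measurable W)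
    (hconj : ∀ z, W (conj z) = W z) {n : ℕ} (hn : n ≠ 0) (z : Fin n → ℂ) {c : ℝ≥0∞}
    (h : gasEnergy W z ≤ 4 * n ^ 2 * c) :
    ∫⁻ x, W x ∂(empiricalProba z : Measure ℂ) ≤ c := by
  have h2 : (2 * n : ℝ≥0∞)⁻¹ * (2 * n : ℝ≥0∞) = 1 :=
    ENNReal.inv_mul_cancel (by simpa using hn) (by finiteness)
  have h3 : ∑ i, W (doubled z i) = 2 * ∑ a, W (z a) := by
    simp only [Fin.sum_univ_add, doubled, Fin.append_left, Fin.append_right, hconj]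
    ring
  rw [coe_empiricalProba hn, lintegral_empiricalMeasure hn z hW, h3]
  calc (2 * n : ℝ≥0∞)⁻¹ * (2 * ∑ a, W (z a))
      = ((2 * n : ℝ≥0∞)⁻¹ * (2 * n : ℝ≥0∞)) * ((2 * n : ℝ≥0∞)⁻¹ * (2 * ∑ a, W (z a))) := by
        rw [h2, one_mul]
    _ = (2 * n : ℝ≥0∞)⁻¹ * ((2 * n : ℝ≥0∞)⁻¹ * (4 * n * ∑ a, W (z a))) := by ring
    _ ≤ (2 * n : ℝ≥0∞)⁻¹ * ((2 * n : ℝ≥0∞)⁻¹ * (4 * n ^ 2 * c)) := by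
        exact mul_le_mul' le_rfl (mul_le_mul' le_rfl ((four_mul_sum_le_gasEnergy hconj z).trans h))
    _ = c := four_mul_sq_inv_mul hn c

/-- Truncating the kernel makes the self-interactions of the points negligible. -/
lemma fieldEnergyTrunc_empiricalProba_le {W : ℂ → ℝ≥0∞} (hW : Measurable W) {n : ℕ} (hn : n ≠ 0)
    (z : Fin n → ℂ) {c : ℝ≥0∞} (h : gasEnergy W z ≤ 4 * n ^ 2 * c) (M : ℕ) :
    fieldEnergyTrunc W M (empiricalProba z : Measure ℂ) ≤ c + M * (2 * n : ℝ≥0∞)⁻¹ := by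
  have hm : Measurable fun p : ℂ × ℂ => min (fieldKernel W p.1 p.2) M :=
    (measurable_fieldKernel hW).min measurable_const
  have h2 : (2 * n : ℝ≥0∞)⁻¹ * (2 * n : ℝ≥0∞) = 1 :=
    ENNReal.inv_mul_cancel (by simpa using hn) (by finiteness)
  have hleft : ∀ x, Measurable fun y => min (fieldKernel W x y) M := fun x =>
    (measurable_fieldKernel_comp hW measurable_const measurable_id).min measurable_const
  rw [fieldEnergyTrunc, lintegral_prod _ hm.aemeasurable, coe_empiricalProba hn]
  simp_rw [lintegral_empiricalMeasure hn z (hleft _)]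
  have hsum : Measurable fun x =>
      (2 * n : ℝ≥0∞)⁻¹ * ∑ i, min (fieldKernel W x (doubled z i)) M :=
    (Finset.measurable_sum _ fun i _ =>
      (measurable_fieldKernel_comp hW measurable_id measurable_const).min
        measurable_const).const_mul _
  rw [lintegral_empiricalMeasure hn z hsum, ← Finset.mul_sum]
  have h3 : ∑ i, ∑ j, min (fieldKernel W (doubled z i) (doubled z j)) M ≤
      4 * n ^ 2 * c + (2 * n) * M := by
    rw [← Finset.sum_product', ← Finset.diag_union_offDiag,
      Finset.sum_union (Finset.disjoint_diag_offDiag _), add_comm]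
    refine add_le_add ?_ ?_
    · refine le_trans (Finset.sum_le_sum fun p _ => min_le_left _ _) (le_trans ?_ h)
      exact le_self_add
    · refine (Finset.sum_le_sum fun p _ => min_le_right _ _).trans (le_of_eq ?_)
      rw [Finset.sum_const, Finset.diag_card, Finset.card_univ, Fintype.card_fin, nsmul_eq_mul]
      push_cast; ring
  calc _ ≤ (2 * n : ℝ≥0∞)⁻¹ * ((2 * n : ℝ≥0∞)⁻¹ * (4 * n ^ 2 * c + (2 * n) * M)) := by gcongr
    _ = (2 * n : ℝ≥0∞)⁻¹ * ((2 * n : ℝ≥0∞)⁻¹ * (4 * n ^ 2 * c)) +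
        ((2 * n : ℝ≥0∞)⁻¹ * (2 * n)) * (M * (2 * n : ℝ≥0∞)⁻¹) := by ring
    _ = _ := by rw [four_mul_sq_inv_mul hn, h2, one_mul]

/-- Configurations of asymptotically minimal energy equidistribute according to the unique
minimizer: they are relatively compact, and the truncated energies, which are continuous, show that
every limit point has minimal energy. -/
theorem tendsto_empiricalMeasure {W : ℂ → ℝ≥0∞} (hW : Continuous W) (hgr : HasLogGrowth W)
    (hconj : ∀ z, W (conj z) = W z) {μ : ProbabilityMeasure ℂ}
    (hfin : fieldEnergy W (μ : Measure ℂ) ≠ ⊤)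
    (huniq : ∀ ν : ProbabilityMeasure ℂ, ν ≠ μ →
      fieldEnergy W (μ : Measure ℂ) < fieldEnergy W (ν : Measure ℂ))
    (z : (n : ℕ) → Fin n → ℂ)
    (hz : ∀ k : ℕ, ∀ᶠ n : ℕ in atTop, gasEnergy W (z n) <
      4 * n ^ 2 * (fieldEnergy W (μ : Measure ℂ) + ((1 / ((k : ℝ≥0) + 1) : ℝ≥0) : ℝ≥0∞))) :
    Tendsto (fun n => empiricalMeasure (z n)) atTop (𝓝 μ.toFiniteMeasure) := by
  set m := fieldEnergy W (μ : Measure ℂ) with hm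
  have hmain : Tendsto (fun n => empiricalProba (z n)) atTop (𝓝 μ) := by
    refine IsCompact.tendsto_nhds_of_unique_mapClusterPt
      (isCompact_closure_setOf_lintegral_le hW.measurable hgr (t := m + 1) (by finiteness)) ?_ ?_
    · filter_upwards [hz 0, eventually_ne_atTop 0] with n hn hn0
      refine subset_closure ?_
      refine lintegral_empiricalProba_le hW.measurable hconj hn0 (z n) (hn.le.trans (le_of_eq ?_))
      simp
    · intro ν _ hν
      by_contra hne
      refine absurd (huniq ν hne) (not_lt.2 ?_)
      rw [← iSup_fieldEnergyTrunc hW]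
      refine iSup_le fun M => ?_
      have hbound : ∀ k : ℕ, fieldEnergyTrunc W M (ν : Measure ℂ) ≤
          m + ((1 / ((k : ℝ≥0) + 1) : ℝ≥0) : ℝ≥0∞) + ((1 / ((k : ℝ≥0) + 1) : ℝ≥0) : ℝ≥0∞) := by
        intro k
        by_contra hlt
        rw [not_le] at hlt
        have hfreq := hν.frequently
          ((continuous_fieldEnergyTrunc hW M).continuousAt.eventually_const_lt hlt)
        refine hfreq ?_
        have hlim : Tendsto (fun n : ℕ => (M : ℝ≥0∞) * (2 * n : ℝ≥0∞)⁻¹) atTop (𝓝 (M * 0)) := by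
          refine ENNReal.Tendsto.const_mul ?_ (Or.inr (by simp))
          have h1 : Tendsto (fun n : ℕ => (n : ℝ≥0∞)⁻¹) atTop (𝓝 0) :=
            ENNReal.tendsto_inv_nat_nhds_zero
          refine tendsto_of_tendsto_of_tendsto_of_le_of_le tendsto_const_nhds h1
            (fun _ => bot_le) fun n => ?_
          exact ENNReal.inv_le_inv.2 (le_mul_of_one_le_left' (by norm_num))
        rw [mul_zero] at hlim
        have hpos : (0 : ℝ≥0∞) < ((1 / ((k : ℝ≥0) + 1) : ℝ≥0) : ℝ≥0∞) := by
          rw [ENNReal.coe_pos]; positivity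
        filter_upwards [hz k, eventually_ne_atTop 0, hlim.eventually_lt_const hpos]
          with n hn hn0 hnM
        rw [not_lt]
        refine (fieldEnergyTrunc_empiricalProba_le hW.measurable hn0 (z n) hn.le M).trans ?_
        gcongr
      have hlim : Tendsto (fun k : ℕ => m + ((1 / ((k : ℝ≥0) + 1) : ℝ≥0) : ℝ≥0∞) +
          ((1 / ((k : ℝ≥0) + 1) : ℝ≥0) : ℝ≥0∞)) atTop (𝓝 (m + 0 + 0)) := by
        have h1 : Tendsto (fun k : ℕ => ((1 / ((k : ℝ≥0) + 1) : ℝ≥0) : ℝ≥0∞)) atTop (𝓝 0) := by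
          rw [← ENNReal.coe_zero, ENNReal.tendsto_coe]
          exact tendsto_one_div_add_atTop_nhds_zero_nat
        exact (tendsto_const_nhds.add h1).add h1
      simp only [add_zero] at hlim
      exact ge_of_tendsto' hlim hbound
  rw [ProbabilityMeasure.tendsto_nhds_iff_toFiniteMeasure_tendsto_nhds] at hmain
  refine hmain.congr' ?_
  filter_upwards [eventually_ne_atTop 0] with n hn
  refine Subtype.ext ?_
  exact coe_empiricalProba hn (z n)

/-! ### Comparison with the weighted logarithmic energy -/

/-- For `C` an upper bound of `log (1 + |z|²)` on the compact set where the growth condition may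
fail, `sphField V C` is not truncated and still grows like `δ log (1 + |z|²)`. -/
lemma exists_shift {V : ℂ → ℝ≥0∞}
    (hgrowth : ∃ δ : ℝ, 0 < δ ∧ ∀ᶠ z in cocompact ℂ,
      ENNReal.ofReal ((1 + δ) * Real.log (‖z‖ ^ 2 + 1)) ≤ V z) :
    ∃ C : ℝ≥0, (∀ z, ENNReal.ofReal (logGrowth z) ≤ V z + C) ∧ HasLogGrowth (sphField V C) := by
  obtain ⟨δ, hδ, h⟩ := hgrowth
  obtain ⟨K, hK, hsub⟩ := mem_cocompact.1 h
  obtain ⟨B, hB⟩ := hK.bddAbove_image continuous_logGrowth.continuousOn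
  have hout : ∀ z ∉ K, ENNReal.ofReal ((1 + δ) * logGrowth z) ≤ V z := fun z hz => by
    have := hsub hz
    simpa only [logGrowth, add_comm, Set.mem_ofPred_eq] using this
  have hin : ∀ z ∈ K, logGrowth z ≤ B.toNNReal := fun z hz =>
    (hB (Set.mem_image_of_mem _ hz)).trans (Real.le_coe_toNNReal B)
  have hmain : ∀ z, ENNReal.ofReal ((1 + δ) * logGrowth z) ≤
      V z + ENNReal.ofReal ((1 + δ) * B.toNNReal) := fun z => by
    by_cases hz : z ∈ K
    · refine le_add_left (ENNReal.ofReal_le_ofReal ?_)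
      exact mul_le_mul_of_nonneg_left (hin z hz) (by positivity)
    · exact le_add_right (hout z hz)
  have hC : ∀ z, ENNReal.ofReal (logGrowth z) ≤ V z + B.toNNReal := fun z => by
    by_cases hz : z ∈ K
    · refine le_add_left (ENNReal.ofReal_le_of_le_toReal ?_)
      simpa using hin z hz
    · refine le_add_right (le_trans (ENNReal.ofReal_le_ofReal ?_) (hout z hz))
      nlinarith [logGrowth_nonneg z]
  refine ⟨B.toNNReal, hC, δ.toNNReal, ((1 + δ) * B.toNNReal).toNNReal, by simpa using hδ,
    fun z => ?_⟩
  refine (ENNReal.add_le_add_iff_right (ENNReal.ofReal_ne_top (r := logGrowth z))).1 ?_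
  calc (δ.toNNReal : ℝ≥0∞) * ENNReal.ofReal (logGrowth z) + ENNReal.ofReal (logGrowth z)
      = ENNReal.ofReal ((1 + δ) * logGrowth z) := by
        rw [add_mul, one_mul, add_comm (logGrowth z),
          ENNReal.ofReal_add (mul_nonneg hδ.le (logGrowth_nonneg z)) (logGrowth_nonneg z),
          ENNReal.ofReal_mul hδ.le]
        rfl
    _ ≤ V z + ENNReal.ofReal ((1 + δ) * B.toNNReal) := hmain z
    _ ≤ V z + B.toNNReal + ENNReal.ofReal ((1 + δ) * B.toNNReal) := by
        gcongr; exact le_self_add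
    _ = _ := by
        rw [← sphField_add hC, add_right_comm]
        rfl

lemma measurable_logInv : Measurable fun p : ℂ × ℂ => logInv p.1 p.2 := by
  unfold logInv
  fun_prop

/-- The relation between `sphLog` and the positive and negative parts of `log |x - y|⁻¹`. -/
lemma sphLog_add_toENNReal_neg_logInv (x y : ℂ) :
    sphLog x y + (-logInv x y).toENNReal = (logInv x y).toENNReal +
      (ENNReal.ofReal (logGrowth x) + ENNReal.ofReal (logGrowth y)) / 2 := by
  rcases eq_or_ne x y with rfl | h
  · simp [sphLog_self, logInv_self]
  · have hs := log_norm_sub_le h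
    have hx := logGrowth_nonneg x
    have hy := logGrowth_nonneg y
    have h2 : (ENNReal.ofReal (logGrowth x) + ENNReal.ofReal (logGrowth y)) / 2 =
        ENNReal.ofReal ((logGrowth x + logGrowth y) / 2) := by
      rw [ENNReal.ofReal_div_of_pos (by norm_num), ENNReal.ofReal_add hx hy]; simp
    rw [sphLog_of_ne h, logInv_of_ne h, h2, ← EReal.coe_neg, neg_neg,
      EReal.toENNReal_of_ne_top (EReal.coe_ne_top _),
      EReal.toENNReal_of_ne_top (EReal.coe_ne_top _),
      EReal.toReal_coe, EReal.toReal_coe]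
    rcases le_total 0 (Real.log ‖x - y‖) with h0 | h0
    · rw [ENNReal.ofReal_of_nonpos (neg_nonpos.2 h0), zero_add,
        ← ENNReal.ofReal_add (by linarith) h0]
      congr 1; ring
    · rw [ENNReal.ofReal_of_nonpos h0, add_zero,
        ENNReal.ofReal_add (neg_nonneg.2 h0) (by positivity)]

lemma toENNReal_neg_logInv_le (x y : ℂ) :
    (-logInv x y).toENNReal ≤ ENNReal.ofReal (logGrowth x) + ENNReal.ofReal (logGrowth y) := by
  have hx := logGrowth_nonneg x
  have hy := logGrowth_nonneg y
  rcases eq_or_ne x y with rfl | h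
  · simp [logInv_self]
  · rw [logInv_of_ne h, ← EReal.coe_neg, neg_neg, EReal.toENNReal_of_ne_top (EReal.coe_ne_top _),
      EReal.toReal_coe, ← ENNReal.ofReal_add hx hy]
    exact ENNReal.ofReal_le_ofReal ((log_norm_sub_le h).trans (by linarith))

lemma lintegral_logGrowth_prod (μ : Measure ℂ) [IsProbabilityMeasure μ] :
    ∫⁻ p, (ENNReal.ofReal (logGrowth p.1) + ENNReal.ofReal (logGrowth p.2)) ∂(μ.prod μ) =
      logMoment μ + logMoment μ := by
  have hm : Measurable fun z => ENNReal.ofReal (logGrowth z) :=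
    continuous_logGrowth.measurable.ennreal_ofReal
  have hm1 : Measurable fun p : ℂ × ℂ => ENNReal.ofReal (logGrowth p.1) := hm.comp measurable_fst
  rw [lintegral_add_left hm1, measurePreserving_fst.lintegral_comp hm,
    measurePreserving_snd.lintegral_comp hm]
  rfl

lemma sphEnergy_add_lintegral_neg_logInv (μ : Measure ℂ) [IsProbabilityMeasure μ] :
    sphEnergy μ μ + ∫⁻ p, (-logInv p.1 p.2).toENNReal ∂(μ.prod μ) =
      ∫⁻ p, (logInv p.1 p.2).toENNReal ∂(μ.prod μ) + logMoment μ := by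
  have hm : Measurable fun z => ENNReal.ofReal (logGrowth z) :=
    continuous_logGrowth.measurable.ennreal_ofReal
  have hmsum : Measurable fun p : ℂ × ℂ =>
      ENNReal.ofReal (logGrowth p.1) + ENNReal.ofReal (logGrowth p.2) :=
    (hm.comp measurable_fst).add (hm.comp measurable_snd)
  have hpos : Measurable fun p : ℂ × ℂ => (logInv p.1 p.2).toENNReal :=
    measurable_logInv.ereal_toENNReal
  have hhalf : ∫⁻ p, (ENNReal.ofReal (logGrowth p.1) + ENNReal.ofReal (logGrowth p.2)) / 2
      ∂(μ.prod μ) = logMoment μ := by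
    simp_rw [div_eq_mul_inv]
    rw [lintegral_mul_const _ hmsum, lintegral_logGrowth_prod, ← div_eq_mul_inv,
      ← two_mul, mul_comm, ENNReal.mul_div_cancel_right (by simp) (by simp)]
  rw [← hhalf, ← lintegral_add_left hpos, sphEnergy, ← lintegral_add_left measurable_sphLog]
  exact lintegral_congr fun p => sphLog_add_toENNReal_neg_logInv p.1 p.2

/-- The spherical energy in the field `sphField V C` is the weighted logarithmic energy, up to the
additive constant `C`; this includes the measures for which the former is infinite. -/
theorem coe_fieldEnergy {V : ℂ → ℝ≥0∞} {C : ℝ≥0} (hV : Continuous V)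
    (hC : ∀ z, ENNReal.ofReal (logGrowth z) ≤ V z + C) (hgr : HasLogGrowth (sphField V C))
    (μ : Measure ℂ) [IsProbabilityMeasure μ] :
    (fieldEnergy (sphField V C) μ : EReal) = weightedEnergy V μ + ((C : ℝ) : EReal) := by
  have hW := (continuous_sphField hV C).measurable
  have hm : Measurable fun z => ENNReal.ofReal (logGrowth z) :=
    continuous_logGrowth.measurable.ennreal_ofReal
  have hVint : ∫⁻ z, sphField V C z ∂μ + logMoment μ = ∫⁻ z, V z ∂μ + C := by
    rw [logMoment, ← lintegral_add_left hW, lintegral_congr fun z => sphField_add hC z,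
      lintegral_add_left hV.measurable]
    simp
  rw [weightedEnergy]
  split_ifs with htop
  -- if the field were integrable, so would be `log (1 + |z|²)`, hence `V`
  · have h1 : ∫⁻ z, sphField V C z ∂μ = ⊤ := by
      by_contra hne
      have hlog := hgr.logMoment_ne_top hne
      rw [htop, top_add] at hVint
      exact ENNReal.add_ne_top.2 ⟨hne, hlog⟩ hVint
    rw [fieldEnergy_eq hW, h1]
    simp
  · have hsum : ∫⁻ z, sphField V C z ∂μ + logMoment μ ≠ ⊤ := by
      rw [hVint]; finiteness
    have hlog : logMoment μ ≠ ⊤ := (ENNReal.add_ne_top.1 hsum).2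
    obtain ⟨N, hN⟩ : ∃ N, N = ∫⁻ p, (-logInv p.1 p.2).toENNReal ∂(μ.prod μ) := ⟨_, rfl⟩
    obtain ⟨Q, hQ⟩ : ∃ Q, Q = ∫⁻ p, (logInv p.1 p.2).toENNReal ∂(μ.prod μ) := ⟨_, rfl⟩
    generalize ∫⁻ z, V z ∂μ = v at *
    have hNtop : N ≠ ⊤ := by
      refine ne_top_of_le_ne_top (ENNReal.add_ne_top.2 ⟨hlog, hlog⟩) ?_
      rw [hN, ← lintegral_logGrowth_prod μ]
      exact lintegral_mono fun p => toENNReal_neg_logInv_le p.1 p.2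
    -- `Q` and `N` are the integrals of the positive and negative part of the planar kernel
    have h1 : sphEnergy μ μ + N = Q + logMoment μ := by
      rw [hN, hQ, sphEnergy_add_lintegral_neg_logInv]
    have h2 : fieldEnergy (sphField V C) μ + N = Q + v + C := by
      rw [fieldEnergy_eq hW, add_right_comm, h1, add_assoc, add_comm (logMoment μ), hVint,
        add_assoc]
    have h3 : logEnergy μ = (Q : EReal) - (N : EReal) := by
      rw [logEnergy, extIntegral, hQ, hN]
    rw [h3]
    generalize fieldEnergy (sphField V C) μ = F at h2 ⊢
    clear hN hQ
    lift N to ℝ≥0 using hNtop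
    lift v to ℝ≥0 using htop
    rcases eq_or_ne Q ⊤ with rfl | hQtop
    · have : F = ⊤ := by
        by_contra hne
        rw [top_add, top_add] at h2
        exact ENNReal.add_ne_top.2 ⟨hne, ENNReal.coe_ne_top⟩ h2
      rw [this]
      rfl
    · lift Q to ℝ≥0 using hQtop
      have hF : F ≠ ⊤ := by
        rintro rfl
        rw [top_add] at h2
        exact absurd h2.symm (by finiteness)
      lift F to ℝ≥0 using hF
      have h4 : (F : ℝ) + N = Q + v + C := by exact_mod_cast h2
      have h5 : (F : ℝ) = Q - N + v + C := by linarith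
      have h6 : ((F : ℝ) : EReal) = ((Q - N + v + C : ℝ) : EReal) := by rw [h5]
      rw [EReal.coe_add, EReal.coe_add, EReal.coe_sub] at h6
      exact h6

/-- Positive capacity of `{V < ∞}` provides a measure of finite energy: a continuous `V` is bounded
on a compact support on which it is finite. -/
lemma exists_fieldEnergy_ne_top {V : ℂ → ℝ≥0∞} {C : ℝ≥0} (hV : Continuous V)
    (hC : ∀ z, ENNReal.ofReal (logGrowth z) ≤ V z + C) (hgr : HasLogGrowth (sphField V C))
    (hcap : HasPositiveCapacity {z | V z < ⊤}) :
    ∃ μ : ProbabilityMeasure ℂ, fieldEnergy (sphField V C) (μ : Measure ℂ) ≠ ⊤ := by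
  obtain ⟨μ, hK, hsub, hlog⟩ := hcap
  refine ⟨μ, ?_⟩
  have hsupp : ∀ᵐ z ∂(μ : Measure ℂ), z ∈ (μ : Measure ℂ).support := Measure.support_mem_ae
  have hne : (μ : Measure ℂ).support.Nonempty := hsupp.exists
  obtain ⟨x, hx, hmax⟩ := hK.exists_isMaxOn hne hV.continuousOn
  have hVint : ∫⁻ z, V z ∂(μ : Measure ℂ) ≠ ⊤ := by
    refine ne_top_of_le_ne_top (hsub hx).ne ?_
    calc ∫⁻ z, V z ∂(μ : Measure ℂ) ≤ ∫⁻ _, V x ∂(μ : Measure ℂ) :=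
          lintegral_mono_ae (hsupp.mono fun z hz => hmax hz)
      _ = V x := by simp
  have h : (fieldEnergy (sphField V C) (μ : Measure ℂ) : EReal) < ⊤ := by
    rw [coe_fieldEnergy hV hC hgr, weightedEnergy, if_neg hVint]
    refine EReal.add_lt_top (EReal.add_lt_top hlog.ne ?_).ne (EReal.coe_ne_top _)
    simpa using hVint
  intro htop
  rw [htop] at h
  exact lt_irrefl _ h

end QuatGas

theorem mainTheorem1 (V : ℂ → ℝ≥0∞) (hV : Continuous V) (hconj : ∀ z, V (conj z) = V z)
    (hgrowth : ∃ δ : ℝ, 0 < δ ∧ ∀ᶠ z in cocompact ℂ,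
      ENNReal.ofReal ((1 + δ) * Real.log (‖z‖ ^ 2 + 1)) ≤ V z)
    (hcap : QuatGas.HasPositiveCapacity {z | V z < ⊤}) :
    ∃ μV : ProbabilityMeasure ℂ,
      IsCompact (μV : Measure ℂ).support ∧
      (∃ E : ℝ, QuatGas.weightedEnergy V (μV : Measure ℂ) = (E : EReal)) ∧
      (∀ ν : ProbabilityMeasure ℂ, ν ≠ μV →
        QuatGas.weightedEnergy V (μV : Measure ℂ) < QuatGas.weightedEnergy V (ν : Measure ℂ)) ∧
      ∀ (Ω : Type*) [MeasurableSpace Ω] (P : Measure Ω) [IsProbabilityMeasure P]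
        (z : (n : ℕ) → Ω → Fin n → ℂ),
        (∀ n, 1 ≤ n → HasLaw (z n) (QuatGas.gasLaw V n) P) →
        ∀ᵐ ω ∂P, Tendsto (fun n => QuatGas.empiricalMeasure (z n ω)) atTop
          (𝓝 μV.toFiniteMeasure) := by
  open QuatGas in
  obtain ⟨C, hC, hgr⟩ := exists_shift hgrowth
  have hW := continuous_sphField hV C
  have hWconj := sphField_conj hconj C
  obtain ⟨μ, hfin, hK, huniq⟩ :=
    exists_equilibrium_measure hW hgr (exists_fieldEnergy_ne_top hV hC hgr hcap)
  refine ⟨μ, hK, ?_, fun ν hν => ?_, ?_⟩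
  · have h := coe_fieldEnergy hV hC hgr (μ : Measure ℂ)
    lift fieldEnergy (sphField V C) (μ : Measure ℂ) to ℝ≥0 using hfin with F
    generalize weightedEnergy V (μ : Measure ℂ) = E at h ⊢
    induction E with
    | bot => simp at h
    | top => simp at h
    | coe E => exact ⟨E, rfl⟩
  · have h := EReal.coe_ennreal_lt_coe_ennreal_iff.2 (huniq ν hν)
    rw [coe_fieldEnergy hV hC hgr, coe_fieldEnergy hV hC hgr] at h
    exact lt_of_add_lt_add_right h
  · intro Ω _ P _ z hz
    have h : ∀ᵐ ω ∂P, ∀ k : ℕ, ∀ᶠ n : ℕ in atTop, gasEnergy (sphField V C) (z n ω) <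
        4 * n ^ 2 * (fieldEnergy (sphField V C) (μ : Measure ℂ) +
          ((1 / ((k : ℝ≥0) + 1) : ℝ≥0) : ℝ≥0∞)) :=
      ae_all_iff.2 fun k =>
        ae_eventually_gasEnergy_lt hC hV hconj hgr (μ : Measure ℂ) hfin P z hz (by positivity)
    filter_upwards [h] with ω hω
    exact tendsto_empiricalMeasure hW hgr hWconj hfin huniq (fun n => z n ω) hω
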